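/- **Setting.** A *turn-based multiplayer game* $\mathcal G$ consists of a non-empty finite set $P$ of players, a finite directed graph $(V,E)$ in which every vertex has a successor, a partition $V=\biguplus_{j\in P}V_j$, and a payoff function $p_j$ for each player $j$, assigning a real number to every infinite path (*outcome*). A *history* is a non-empty finite path. A *strategy* of player $j$ assigns to each history whose last vertex $v$ lies in $V_j$ a successor of $v$. Fix a player $i$ and an initial vertex $v_0$. A strategy $\sigma$ of player $i$ together with a profile $\tau$ of strategies of all other players determines an outcome from $v_0$; its payoff for player $i$ is denoted $p_i(\sigma,\tau)$. $\mathcal G$ is a *generalised safety/reachability game* for player $i$ if there are a set $L\subseteq V$ of leaves and integers $(n_\ell)_{\ell\in L}$ such that the only outgoing edge of each $\ell\in L$ is the self-loop $(\ell,\ell)$, and $p_i(\rho)=n_\ell$ if the outcome $\rho$ is eventually constantly equal to $\ell\in L$, while $p_i(\rho)=0$ if $\rho$ ends up in no leaf. **Dominance.** For strategies $\sigma,\sigma'$ of player $i$, write $\sigma\preceq\sigma'$ if $p_i(\sigma,\tau)\le p_i(\sigma',\tau)$ for all $\tau$, and $\sigma\prec\sigma'$ ($\sigma$ is *dominated* by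 $\sigma'$) if moreover $p_i(\sigma,\tau)<p_i(\sigma',\tau)$ for some $\tau$. A strategy is *admissible* if it is not dominated by any strategy of player $i$. An *increasing chain* is a family $(\sigma_\beta)_{\beta<\alpha}$ of strategies of player $i$, indexed by an ordinal $\alpha$, with $\sigma_\beta\prec\sigma_\gamma$ whenever $\beta<\gamma<\alpha$. For chains, $(\sigma_\beta)_{\beta<\alpha}\sqsubseteq(\tau_\gamma)_{\gamma<\delta}$ (the first is *dominated* by the second) means that for every $\beta<\alpha$ there is $\gamma<\delta$ with $\sigma_\beta\preceq\tau_\gamma$; a single strategy is regarded as a chain of length one. **Automata.** A *Mealy automaton* for player $i$ has a finite set $M$ of memory states, an initial state $m_0\in M$, an update function $\mu:M\times V\to M$ and a move function $\nu:M\times V_i\to V$ with $(v,\nu(m,v))\in E$. It realizes the strategy $v_0'\dots v_k'\mapsto\nu(m_k,v_k')$, where $m_{j+1}=\mu(m_j,v_j')$. A strategy is *finite-memory* if it is realized by some Mealy automaton. A *parameterized automaton* has in addition a set $M_C\subseteq M$ of counter-access states, and functions $\mu:M\times V\times\mathbb N\to M\times\mathbb N$ and $\nu:M\times V_i\times\mathbb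 N\to V$, with $(v,\nu(m,v,n))\in E$, such that: - if $m\notin M_C$, then $\nu(m,v,n)$ does not depend on $n$, and $\mu(m,v,n)=(m',n)$ with $m'$ independent of $n$; - if $m\in M_C$, then $\nu(m,v,n)$ is the same for all $n>0$, $\mu(m,v,n)=(m',n-1)$ for all $n>0$ with $m'$ independent of $n$, and $\mu(m,v,0)=(m'',0)$ for some $m''$. With its counter initialized to $n\in\mathbb N$ (initial configuration $(m_0,n)$), it realizes a strategy $\sigma_n$ in the same way as a Mealy automaton. A *maximal uniform chain* is an increasing chain $(\sigma_n)_{n\in\mathbb N}$ of finite-memory strategies of player $i$ such that some parameterized automaton realizes $\sigma_n$ when its counter is initialized to $n$, for every $n\in\mathbb N$, and such that for every increasing chain $B$ of finite-memory strategies of player $i$, $(\sigma_n)_{n\in\mathbb N}\sqsubseteq B$ implies $B\sqsubseteq(\sigma_n)_{n\in\mathbb N}$. **Theorem.** Let $\mathcal G$ be a generalised safety/reachability game for player $i$ with initial vertex $v_0$, and let $\sigma$ be a finite-memory strategy of player $i$ that is dominated by some strategy of player $i$. Then $\sigma$ is dominated by an admissible finite-memory strategy of player $i$, or $\sigma$ is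 dominated by a maximal uniform chain. -/

import Mathlib

namespace SafetyReach

/-- The board of a turn-based game: each vertex belongs to exactly one player, and every vertex
has a successor (so that every play goes on forever). -/
structure Arena (P V : Type*) where
  owner : V → P
  Edge : V → V → Prop
  exists_succ : ∀ v, ∃ w, Edge v w

namespace Arena

variable {P V : Type*} (A : Arena P V)

/-- An outcome is an infinite path. -/
def Outcome : Type _ := {ρ : ℕ → V // ∀ k, A.Edge (ρ k) (ρ (k + 1))}

/-- A history is a finite path with at least one vertex: `past` lists the vertices before the
last one, oldest first. -/
@[ext] structure History where
  past : List V
  last : V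
  isPath : (past ++ [last]).IsChain A.Edge

variable {A}

namespace History

/-- The history consisting of one vertex. -/
def single (v : V) : A.History := ⟨[], v, by simp⟩

/-- Prolong a history by one edge. -/
def snoc (h : A.History) (w : V) (hw : A.Edge h.last w) : A.History where
  past := h.past ++ [h.last]
  last := w
  isPath := by
    have h1 := h.isPath
    rw [List.isChain_append]
    refine ⟨h1, by simp, ?_⟩
    intro x hx y hy
    simp at hx hy
    subst hx hy
    exact hw

end History

variable (A)

/-- A strategy of player `j` chooses a successor of the last vertex of every history that ends
in a vertex of player `j`. -/
@[ext] structure Strategy (j : P) where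
  move : (h : A.History) → A.owner h.last = j → V
  legal : ∀ h hj, A.Edge h.last (move h hj)

/-- A strategy profile: one strategy for each player. -/
abbrev Profile := (j : P) → A.Strategy j

/-- A profile of strategies of all the players other than `i`. -/
abbrev CoProfile (i : P) := (j : P) → j ≠ i → A.Strategy j

variable {A}

open Classical in
/-- The complete profile `(σ, τ)`. -/
noncomputable def CoProfile.join {i : P} (τ : A.CoProfile i) (σ : A.Strategy i) : A.Profile :=
  fun j => if h : j = i then h ▸ σ else τ j h

/-- One step of play: the owner of the last vertex moves. -/
def Profile.step (π : A.Profile) (h : A.History) : A.History :=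
  h.snoc ((π (A.owner h.last)).move h rfl) ((π (A.owner h.last)).legal h rfl)

/-- The history reached after `k` moves from `v₀`. -/
def Profile.play (π : A.Profile) (v₀ : V) : ℕ → A.History
  | 0 => History.single v₀
  | k + 1 => Profile.step π (Profile.play π v₀ k)

/-- The outcome of a profile from `v₀`. -/
def Profile.outcome (π : A.Profile) (v₀ : V) : A.Outcome :=
  ⟨fun k => (Profile.play π v₀ k).last, fun k => (π _).legal (Profile.play π v₀ k) rfl⟩

variable (A)

/-- A Mealy automaton for player `i`: a finite set of memory states, an initial state, a memory
update function and a move choice function. -/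
structure Mealy (i : P) where
  M : Type
  finite : Finite M
  init : M
  update : M → V → M
  choose : M → (v : V) → A.owner v = i → V
  legal : ∀ m v hv, A.Edge v (choose m v hv)

/-- A parameterized automaton for player `i`: a Mealy automaton with a counter. In a state outside
`access` the counter is neither read nor changed; in a state of `access` a transition is
chosen according to whether the counter is zero, and a nonzero counter is decremented. -/
structure ParamAutomaton (i : P) where
  M : Type
  finite : Finite M
  access : Set M
  init : M
  update : M → V → ℕ → M × ℕ
  choose : M → (v : V) → A.owner v = i → ℕ → V
  legal : ∀ m v hv n, A.Edge v (choose m v hv n)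
  update_black : ∀ m ∉ access, ∀ v, ∃ m', ∀ n, update m v n = (m', n)
  update_green : ∀ m ∈ access, ∀ v, ∃ m', ∀ n > 0, update m v n = (m', n - 1)
  update_red : ∀ m ∈ access, ∀ v, ∃ m', update m v 0 = (m', 0)
  choose_black : ∀ m ∉ access, ∀ v hv, ∃ w, ∀ n, choose m v hv n = w
  choose_green : ∀ m ∈ access, ∀ v hv, ∃ w, ∀ n > 0, choose m v hv n = w

variable {A}

/-- The strategy realized by a Mealy automaton: at a history `h`, the memory has been updated
along all vertices of `h` but the last, and the move depends on the memory and the last vertex. -/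
def Mealy.strategy {i : P} (𝓜 : A.Mealy i) : A.Strategy i where
  move h hi := 𝓜.choose (h.past.foldl 𝓜.update 𝓜.init) h.last hi
  legal _ _ := 𝓜.legal _ _ _

/-- Memory state and counter value at the end of the history `h`, when the counter is
initialized with `n`. -/
def ParamAutomaton.config {i : P} (𝓜 : A.ParamAutomaton i) (n : ℕ) (h : A.History) : 𝓜.M × ℕ :=
  h.past.foldl (fun q v => 𝓜.update q.1 v q.2) (𝓜.init, n)

/-- The strategy realized by a parameterized automaton when its counter is initialized
with `n`. -/
def ParamAutomaton.strategy {i : P} (𝓜 : A.ParamAutomaton i) (n : ℕ) : A.Strategy i where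
  move h hi := 𝓜.choose (𝓜.config n h).1 h.last hi (𝓜.config n h).2
  legal _ _ := 𝓜.legal _ _ _ _

/-- A finite-memory strategy is one realized by a Mealy automaton. -/
def Strategy.FiniteMemory {i : P} (σ : A.Strategy i) : Prop :=
  ∃ 𝓜 : A.Mealy i, 𝓜.strategy = σ

end Arena

open Arena

/-- A turn-based multiplayer game: an arena and a real payoff function for each player. -/
structure Game (P V : Type*) extends Arena P V where
  payoff : P → toArena.Outcome → ℝ

namespace Game

variable {P V : Type*} (G : Game P V)

/-- `G` is a generalised safety/reachability game for player `i`: there is a set `L` of leaves,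
whose only outgoing edge is a self-loop, with integer payoffs `n`, such that an outcome that
ends up in a leaf yields player `i` the payoff of this leaf, and any other outcome yields `0`. -/
def IsGenSafetyReach (i : P) : Prop :=
  ∃ (L : Set V) (n : L → ℤ),
    (∀ l ∈ L, ∀ w, G.Edge l w ↔ w = l) ∧
    (∀ ρ : G.Outcome, ∀ l : L, (∃ N, ∀ k ≥ N, ρ.1 k = l) → G.payoff i ρ = n l) ∧
    (∀ ρ : G.Outcome, (¬ ∃ l : L, ∃ N, ∀ k ≥ N, ρ.1 k = l) → G.payoff i ρ = 0)

variable {i : P}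

/-- The payoff of player `i` in the game started at `v₀`, for the profile `(σ, τ)`. -/
noncomputable def pay (v₀ : V) (σ : G.Strategy i) (τ : G.CoProfile i) : ℝ :=
  G.payoff i (Profile.outcome (τ.join σ) v₀)

/-- `σ` is weakly dominated by `σ'` in the game started at `v₀`. -/
def WeakDom (v₀ : V) (σ σ' : G.Strategy i) : Prop :=
  ∀ τ : G.CoProfile i, G.pay v₀ σ τ ≤ G.pay v₀ σ' τ

/-- `σ` is dominated by `σ'` in the game started at `v₀`. -/
def Dom (v₀ : V) (σ σ' : G.Strategy i) : Prop :=
  G.WeakDom v₀ σ σ' ∧ ∃ τ : G.CoProfile i, G.pay v₀ σ τ < G.pay v₀ σ' τ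

/-- A strategy is admissible if no strategy whatsoever dominates it. -/
def Admissible (v₀ : V) (σ : G.Strategy i) : Prop :=
  ∀ σ' : G.Strategy i, ¬ G.Dom v₀ σ σ'

/-- A family of strategies is an increasing chain if it is strictly increasing for dominance. -/
def IsIncreasingChain {ι : Type*} [LT ι] (v₀ : V) (x : ι → G.Strategy i) : Prop :=
  ∀ a b, a < b → G.Dom v₀ (x a) (x b)

/-- The dominance relation `⊑` between chains: every member of `x` is weakly dominated by some
member of `y`. -/
def ChainDom {ι κ : Type*} (v₀ : V) (x : ι → G.Strategy i) (y : κ → G.Strategy i) : Prop :=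
  ∀ a, ∃ b, G.WeakDom v₀ (x a) (y b)

/-- The sequence `x` is a maximal uniform chain: it is an increasing chain of finite-memory
strategies, some parameterized automaton realizes `x n` when its counter is initialized with `n`, and it is maximal for `⊑`
among the (ordinal-indexed) increasing chains of finite-memory strategies. -/
def IsMaximalUniformChain (v₀ : V) (x : ℕ → G.Strategy i) : Prop :=
  G.IsIncreasingChain v₀ x ∧ (∀ n, (x n).FiniteMemory) ∧
  (∃ 𝓜 : G.ParamAutomaton i, ∀ n, 𝓜.strategy n = x n) ∧
  ∀ (α : Ordinal.{0}) (y : Set.Iio α → G.Strategy i),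
    G.IsIncreasingChain v₀ y → (∀ b, (y b).FiniteMemory) →
    G.ChainDom v₀ x y → G.ChainDom v₀ y x

end Game

end SafetyReach

/-!
The value `a v` of a vertex `v` is the largest payoff that player `i` can guarantee from `v`. Value
iteration shows that both sides have optimal positional strategies (`exists_isValuation`): the
positive part of the value of the game stopped after `k` moves increases with `k`, and so does the
negative part, hence everything is stationary after finitely many steps. As two strategies that
separate at a history can be compared only through the worst payoff of one and the best payoff
of the other, dominance is a matter of consistent outcomes (`WeakDom.payoff_le`, `weakDom_of`), and a
strategy can be improved at a history only if it cannot get more there than the value.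

So `σ` is imitated as long as some continuation gets more than the value of the current vertex,
and is abandoned afterwards for a strategy that guarantees the value. The latter should also, where
possible, leave the opponents an opportunity to let player `i` get more than the value, a surplus
(`Hopeful`). When the value is at most `0`, any play that preserves it is safe, and one may wait for
this opportunity forever. When it is positive, a leaf has to be reached, and at some vertices
(`Critical`) the progress towards a leaf conflicts with the hope for a surplus. The machine `improve`
uses a counter to decide how many times the hope prevails. Let `t N` be the strategy obtained with
the initial counter value `N`. It weakly dominates `σ`, and it increases with `N`. Let `c` bound the
distances to the surplus. If for some `N` the counter never falls below `c`, then `t N` is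
admissible (`admissible_improve`). Otherwise the strategies `t (c * n)` form a strictly increasing
sequence (`exists_pay_lt_improve`), realized by one automaton with a counter
(`exists_paramAutomaton`).

This sequence is maximal because of `weakDom_improve_of_upper_bound`: if a finite-memory strategy `y`
has a common upper bound `z` with `t N`, and `N` is large compared with the memory of `y`, then
`y ⪯ t N`. The core of the argument is a pumping lemma (`pay_le_of_long_imitation`). If `y` agrees with
`t N` for so long that the counter runs low, then it repeats a memory state at a critical vertex,
and the opponents can trap it in a loop without leaves. Since `z` must guarantee a positive payoff once
the counter of `t N` is exhausted, it leaves this loop, and `y ⪯ z` shows that `y` cannot hope for any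
surplus on the loop.
-/

namespace SafetyReach

/-! ### Outcomes consistent with a strategy -/

namespace Arena

variable {P V : Type*} {A : Arena P V} {i : P}

/-- The history formed by the first `k + 1` vertices of an outcome. -/
def Outcome.hist (ρ : A.Outcome) (k : ℕ) : A.History where
  past := (List.range k).map ρ.1
  last := ρ.1 k
  isPath := by
    induction k with
    | zero => simp
    | succ k ih =>
      rw [List.range_succ, List.map_append, List.isChain_append]
      refine ⟨ih, by simp, fun x hx y hy => ?_⟩
      simp at hx hy
      subst hx hy
      exact ρ.2 k

/-- Two outcomes have the same first `k + 1` vertices. -/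
def Outcome.Agree (k : ℕ) (ρ ρ' : A.Outcome) : Prop := ∀ j ≤ k, ρ.1 j = ρ'.1 j

theorem Outcome.Agree.symm {k : ℕ} {ρ ρ' : A.Outcome} (h : ρ.Agree k ρ') : ρ'.Agree k ρ :=
  fun j hj => (h j hj).symm

theorem Outcome.Agree.trans {k : ℕ} {ρ ρ' ρ'' : A.Outcome} (h : ρ.Agree k ρ')
    (h' : ρ'.Agree k ρ'') : ρ.Agree k ρ'' :=
  fun j hj => (h j hj).trans (h' j hj)

theorem Outcome.Agree.mono {k l : ℕ} {ρ ρ' : A.Outcome} (h : ρ.Agree k ρ') (hl : l ≤ k) :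
    ρ.Agree l ρ' :=
  fun j hj => h j (hj.trans hl)

theorem Outcome.Agree.succ {k : ℕ} {ρ ρ' : A.Outcome} (h : ρ.Agree k ρ')
    (h' : ρ.1 (k + 1) = ρ'.1 (k + 1)) : ρ.Agree (k + 1) ρ' := by
  intro j hj
  rcases Nat.lt_or_eq_of_le hj with hj | rfl
  · exact h j (by omega)
  · exact h'

theorem Outcome.hist_eq {k : ℕ} {ρ ρ' : A.Outcome} (h : ρ.Agree k ρ') :
    ρ.hist k = ρ'.hist k := by
  ext1
  · exact List.map_congr_left fun j hj => h j (List.mem_range.1 hj).le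
  · exact h k le_rfl

theorem Outcome.agree_of_hist_eq {k : ℕ} {ρ ρ' : A.Outcome} (h : ρ.hist k = ρ'.hist k) :
    ρ.Agree k ρ' := by
  intro j hj
  rcases Nat.lt_or_eq_of_le hj with hj | rfl
  · have h1 : (List.range k).map ρ.1 = (List.range k).map ρ'.1 := congrArg History.past h
    exact List.map_inj_left.1 h1 j (List.mem_range.2 hj)
  · exact congrArg History.last h

theorem Strategy.move_congr (s : A.Strategy i) {h h' : A.History} (e : h = h')
    (hi : A.owner h.last = i) (hi' : A.owner h'.last = i) : s.move h hi = s.move h' hi' := by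
  subst e; rfl

/-- The moves of player `i` along `ρ` are those of `s`, for the first `n` moves. -/
def Strategy.FollowedUpto (s : A.Strategy i) (ρ : A.Outcome) (n : ℕ) : Prop :=
  ∀ k < n, ∀ hk : A.owner (ρ.1 k) = i, ρ.1 (k + 1) = s.move (ρ.hist k) hk

/-- The outcome `ρ` is consistent with the strategy `s`. -/
def Strategy.Followed (s : A.Strategy i) (ρ : A.Outcome) : Prop :=
  ∀ k, ∀ hk : A.owner (ρ.1 k) = i, ρ.1 (k + 1) = s.move (ρ.hist k) hk

theorem Strategy.Followed.upto {s : A.Strategy i} {ρ : A.Outcome} (h : s.Followed ρ) (n : ℕ) :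
    s.FollowedUpto ρ n :=
  fun k _ hk => h k hk

theorem Strategy.FollowedUpto.mono {s : A.Strategy i} {ρ : A.Outcome} {m n : ℕ}
    (h : s.FollowedUpto ρ n) (hm : m ≤ n) : s.FollowedUpto ρ m :=
  fun k hk => h k (by omega)

theorem Strategy.FollowedUpto.congr {s : A.Strategy i} {ρ ρ' : A.Outcome} {n : ℕ}
    (h : s.FollowedUpto ρ n) (e : ρ.Agree n ρ') : s.FollowedUpto ρ' n := by
  intro k hk hi
  have h1 := h k hk (by rw [e k (by omega)]; exact hi)
  rw [e (k + 1) (by omega)] at h1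
  exact h1.trans (s.move_congr (Outcome.hist_eq (e.mono (by omega))) _ _)

theorem Strategy.Followed.next_eq {s : A.Strategy i} {ρ ρ' : A.Outcome} {k : ℕ}
    (h : s.Followed ρ) (h' : s.Followed ρ') (e : ρ.Agree k ρ') (hk : A.owner (ρ.1 k) = i) :
    ρ.1 (k + 1) = ρ'.1 (k + 1) := by
  rw [h k hk, h' k (by rw [← e k le_rfl]; exact hk)]
  exact s.move_congr (Outcome.hist_eq e) _ _

/-- A co-profile in which all the opponents use the same reply function. -/
def CoProfile.ofReply (i : P) (f : (h : A.History) → {w // A.Edge h.last w}) : A.CoProfile i :=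
  fun _ _ => ⟨fun h _ => (f h).1, fun h _ => (f h).2⟩

theorem CoProfile.join_move_own (τ : A.CoProfile i) (s : A.Strategy i) (h : A.History)
    (hi : A.owner h.last = i) :
    ((τ.join s) (A.owner h.last)).move h rfl = s.move h hi := by
  have key : ∀ j (e : A.owner h.last = j) (hj : j = i),
      ((τ.join s) j).move h e = s.move h (e.trans hj) := by
    intro j e hj
    subst hj
    simp [CoProfile.join]
  exact key _ rfl hi

theorem CoProfile.join_move_other (τ : A.CoProfile i) (s : A.Strategy i) (h : A.History)
    (hi : A.owner h.last ≠ i) :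
    ((τ.join s) (A.owner h.last)).move h rfl = (τ _ hi).move h rfl := by
  simp [CoProfile.join, hi]

theorem Profile.play_eq_hist (π : A.Profile) (v₀ : V) (k : ℕ) :
    π.play v₀ k = (π.outcome v₀).hist k := by
  induction k with
  | zero => rfl
  | succ k ih =>
    ext1
    · have h1 : (π.play v₀ (k + 1)).past = (π.play v₀ k).past ++ [(π.play v₀ k).last] := rfl
      rw [h1, ih]
      simp [Outcome.hist, List.range_succ]
    · rfl

theorem Profile.outcome_succ (π : A.Profile) (v₀ : V) (k : ℕ) :
    (π.outcome v₀).1 (k + 1) =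
      (π (A.owner ((π.outcome v₀).hist k).last)).move ((π.outcome v₀).hist k) rfl := by
  have h1 : (π.outcome v₀).1 (k + 1) =
      (π (A.owner (π.play v₀ k).last)).move (π.play v₀ k) rfl := rfl
  rw [h1]
  have h2 := Profile.play_eq_hist π v₀ k
  generalize π.play v₀ k = h at h2
  subst h2
  rfl

theorem CoProfile.followed_outcome (τ : A.CoProfile i) (s : A.Strategy i) (v₀ : V) :
    s.Followed ((τ.join s).outcome v₀) := by
  intro k hk
  rw [Profile.outcome_succ]
  exact τ.join_move_own s (((τ.join s).outcome v₀).hist k) hk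

/-- If `s` prescribes the moves of player `i` along the beginning of an outcome of a co-profile,
then the outcome of `s` against this co-profile begins in the same way. -/
theorem CoProfile.agree_outcome (τ : A.CoProfile i) (s s' : A.Strategy i) (v₀ : V) (n : ℕ)
    (h : s.FollowedUpto ((τ.join s').outcome v₀) n) :
    ((τ.join s).outcome v₀).Agree n ((τ.join s').outcome v₀) := by
  induction n with
  | zero => intro j hj; obtain rfl : j = 0 := by omega
            rfl
  | succ n ih =>
    have e := ih (h.mono (by omega))
    refine e.succ ?_
    have e' := Outcome.hist_eq e
    by_cases hk : A.owner (((τ.join s').outcome v₀).1 n) = i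
    · rw [h n (by omega) hk, τ.followed_outcome s v₀ n (by rw [e n le_rfl]; exact hk)]
      exact s.move_congr e' _ _
    · rw [Profile.outcome_succ, Profile.outcome_succ]
      generalize ((τ.join s).outcome v₀).hist n = h1 at e'
      subst e'
      exact (τ.join_move_other s (((τ.join s').outcome v₀).hist n) hk).trans
        (τ.join_move_other s' (((τ.join s').outcome v₀).hist n) hk).symm

theorem CoProfile.agree_of_reply (f : (h : A.History) → {w // A.Edge h.last w})
    (s : A.Strategy i) (ρ : A.Outcome) (n : ℕ) (h : s.FollowedUpto ρ n)
    (hf : ∀ k < n, A.owner (ρ.1 k) ≠ i → (f (ρ.hist k)).1 = ρ.1 (k + 1)) :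
    (((CoProfile.ofReply i f).join s).outcome (ρ.1 0)).Agree n ρ := by
  induction n with
  | zero => intro j hj; obtain rfl : j = 0 := by omega
            rfl
  | succ n ih =>
    have e := ih (h.mono (by omega)) (fun k hk => hf k (by omega))
    refine e.succ ?_
    have e' := Outcome.hist_eq e
    by_cases hk : A.owner (ρ.1 n) = i
    · rw [h n (by omega) hk,
        CoProfile.followed_outcome _ s _ n (by rw [e n le_rfl]; exact hk)]
      exact s.move_congr e' _ _
    · rw [Profile.outcome_succ, ← hf n (by omega) hk]
      rw [e']
      exact CoProfile.join_move_other _ s (ρ.hist n) hk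

theorem CoProfile.outcome_of_reply (f : (h : A.History) → {w // A.Edge h.last w})
    (s : A.Strategy i) (ρ : A.Outcome) (h : s.Followed ρ)
    (hf : ∀ k, A.owner (ρ.1 k) ≠ i → (f (ρ.hist k)).1 = ρ.1 (k + 1)) :
    ((CoProfile.ofReply i f).join s).outcome (ρ.1 0) = ρ :=
  Subtype.ext <| funext fun k =>
    CoProfile.agree_of_reply f s ρ k (h.upto k) (fun k _ => hf k) k le_rfl

open Classical in
/-- Two consistent outcomes which agree until they separate at a vertex of player `i` are the
outcomes of the two strategies against one and the same co-profile. -/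
theorem exists_coProfile_of_diverge (s s' : A.Strategy i) (ρ ρ' : A.Outcome) (k : ℕ)
    (hs : s.Followed ρ) (hs' : s'.Followed ρ') (e : ρ.Agree k ρ')
    (hk : A.owner (ρ.1 k) = i) (hne : ρ.1 (k + 1) ≠ ρ'.1 (k + 1)) :
    ∃ τ : A.CoProfile i, (τ.join s).outcome (ρ.1 0) = ρ ∧ (τ.join s').outcome (ρ.1 0) = ρ' := by
  let f : (h : A.History) → {w // A.Edge h.last w} := fun h =>
    if h1 : h = ρ.hist h.past.length then
      ⟨ρ.1 (h.past.length + 1), by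
        have : h.last = ρ.1 h.past.length := congrArg History.last h1
        rw [this]; exact ρ.2 _⟩
    else if h2 : h = ρ'.hist h.past.length then
      ⟨ρ'.1 (h.past.length + 1), by
        have : h.last = ρ'.1 h.past.length := congrArg History.last h2
        rw [this]; exact ρ'.2 _⟩
    else ⟨_, (A.exists_succ h.last).choose_spec⟩
  have len : ∀ (π : A.Outcome) n, (π.hist n).past.length = n := by
    intro π n; simp [Outcome.hist]
  have f1 : ∀ n, (f (ρ.hist n)).1 = ρ.1 (n + 1) := by
    intro n
    have : ρ.hist n = ρ.hist (ρ.hist n).past.length := by rw [len]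
    simp only [f, dif_pos this, len]
  have f2 : ∀ n, A.owner (ρ'.1 n) ≠ i → (f (ρ'.hist n)).1 = ρ'.1 (n + 1) := by
    intro n hn
    by_cases h1 : ρ'.hist n = ρ.hist n
    · rw [h1, f1]
      have e1 := Outcome.agree_of_hist_eq h1
      rcases lt_trichotomy n k with hl | rfl | hl
      · exact e (n + 1) (by omega)
      · rw [e n le_rfl] at hk; exact absurd hk hn
      · exact absurd (e1 (k + 1) (by omega)).symm hne
    · have h1' : ¬ ρ'.hist n = ρ.hist (ρ'.hist n).past.length := by rw [len]; exact h1
      have h2 : ρ'.hist n = ρ'.hist (ρ'.hist n).past.length := by rw [len]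
      simp only [f]
      rw [dif_neg h1', dif_pos h2]
      simp only [len]
  refine ⟨CoProfile.ofReply i f, CoProfile.outcome_of_reply f s ρ hs fun n _ => f1 n, ?_⟩
  rw [e 0 (by omega)]
  exact CoProfile.outcome_of_reply f s' ρ' hs' f2

theorem exists_coProfile (s : A.Strategy i) (ρ : A.Outcome) (hs : s.Followed ρ) :
    ∃ τ : A.CoProfile i, (τ.join s).outcome (ρ.1 0) = ρ := by
  classical
  let f : (h : A.History) → {w // A.Edge h.last w} := fun h =>
    if h1 : h = ρ.hist h.past.length then
      ⟨ρ.1 (h.past.length + 1), by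
        have : h.last = ρ.1 h.past.length := congrArg History.last h1
        rw [this]; exact ρ.2 _⟩
    else ⟨_, (A.exists_succ h.last).choose_spec⟩
  have len : ∀ n, (ρ.hist n).past.length = n := by
    intro n; simp [Outcome.hist]
  refine ⟨CoProfile.ofReply i f, CoProfile.outcome_of_reply f s ρ hs fun n _ => ?_⟩
  have : ρ.hist n = ρ.hist (ρ.hist n).past.length := by rw [len]
  simp only [f, dif_pos this, len]

open Classical in
/-- A history consistent with `s` is prolonged to an outcome consistent with `s` in which the
opponents henceforth play the positional strategy `ω`. -/
theorem Strategy.FollowedUpto.exists_extend {s : A.Strategy i} {ρ : A.Outcome} {n : ℕ}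
    (h : s.FollowedUpto ρ n) (ω : V → V) (hω : ∀ v, A.Edge v (ω v)) :
    ∃ ρ' : A.Outcome, ρ.Agree n ρ' ∧ s.Followed ρ' ∧
      ∀ k ≥ n, A.owner (ρ'.1 k) ≠ i → ρ'.1 (k + 1) = ω (ρ'.1 k) := by
  let f : (h : A.History) → {w // A.Edge h.last w} := fun h =>
    if h1 : h.past.length < n ∧ h = ρ.hist h.past.length then
      ⟨ρ.1 (h.past.length + 1), by
        have : h.last = ρ.1 h.past.length := congrArg History.last h1.2
        rw [this]; exact ρ.2 _⟩
    else ⟨ω h.last, hω _⟩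
  have len : ∀ (π : A.Outcome) n, (π.hist n).past.length = n := by
    intro π n; simp [Outcome.hist]
  refine ⟨((CoProfile.ofReply i f).join s).outcome (ρ.1 0), ?_,
    CoProfile.followed_outcome _ _ _, fun k hk hi => ?_⟩
  · refine (CoProfile.agree_of_reply f s ρ n h fun k hk _ => ?_).symm
    have : (ρ.hist k).past.length < n ∧ ρ.hist k = ρ.hist (ρ.hist k).past.length := by
      rw [len]; exact ⟨hk, rfl⟩
    simp only [f, dif_pos this, len]
  · rw [Profile.outcome_succ]
    refine (CoProfile.join_move_other _ s
      ((((CoProfile.ofReply i f).join s).outcome (ρ.1 0)).hist k) hi).trans ?_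
    change (f _).1 = _
    simp only [f]
    rw [dif_neg (by rw [len]; omega)]
    rfl

theorem Strategy.exists_first_deviation {s : A.Strategy i} {ρ : A.Outcome}
    (h : ¬ s.Followed ρ) :
    ∃ (k : ℕ) (hk : A.owner (ρ.1 k) = i), s.FollowedUpto ρ k ∧
      ρ.1 (k + 1) ≠ s.move (ρ.hist k) hk := by
  classical
  have h1 : ∃ k, ∃ hk : A.owner (ρ.1 k) = i, ρ.1 (k + 1) ≠ s.move (ρ.hist k) hk := by
    simpa [Strategy.Followed] using h
  obtain ⟨hk, hne⟩ := Nat.find_spec h1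
  refine ⟨Nat.find h1, hk, fun j hj hi => ?_, hne⟩
  by_contra hcon
  exact Nat.find_min h1 hj ⟨hi, hcon⟩

end Arena

open Arena

/-! ### Dominance in terms of consistent outcomes -/

namespace Game

variable {P V : Type*} {G : Game P V} {i : P} {v₀ : V}

theorem WeakDom.payoff_le {s s' : G.Strategy i} (h : G.WeakDom v₀ s s') {ρ ρ' : G.Outcome}
    (h0 : ρ.1 0 = v₀) {k : ℕ} (hs : s.Followed ρ) (hs' : s'.Followed ρ') (e : ρ.Agree k ρ')
    (hk : G.owner (ρ.1 k) = i) (hne : ρ.1 (k + 1) ≠ ρ'.1 (k + 1)) :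
    G.payoff i ρ ≤ G.payoff i ρ' := by
  obtain ⟨τ, h1, h2⟩ := exists_coProfile_of_diverge s s' ρ ρ' k hs hs' e hk hne
  have h3 := h τ
  rw [h0] at h1 h2
  rwa [Game.pay, Game.pay, h1, h2] at h3

theorem exists_divergence (s s' : G.Strategy i) (τ : G.CoProfile i)
    (hne : (τ.join s).outcome v₀ ≠ (τ.join s').outcome v₀) :
    ∃ k, ((τ.join s).outcome v₀).Agree k ((τ.join s').outcome v₀) ∧
      G.owner (((τ.join s).outcome v₀).1 k) = i ∧
      ((τ.join s).outcome v₀).1 (k + 1) ≠ ((τ.join s').outcome v₀).1 (k + 1) := by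
  have h1 : ¬ s'.Followed ((τ.join s).outcome v₀) := by
    intro h
    refine hne (Subtype.ext (funext fun k => ?_))
    exact ((τ.agree_outcome s' s v₀ k (h.upto k)) k le_rfl).symm
  obtain ⟨k, hk, h2, h3⟩ := Strategy.exists_first_deviation h1
  have e := (τ.agree_outcome s' s v₀ k h2).symm
  refine ⟨k, e, hk, fun h4 => h3 ?_⟩
  rw [h4, τ.followed_outcome s' v₀ k (by rw [← e k le_rfl]; exact hk)]
  exact s'.move_congr (Outcome.hist_eq e.symm) _ _

theorem weakDom_of {s s' : G.Strategy i}
    (h : ∀ (ρ ρ' : G.Outcome) (k : ℕ), ρ.1 0 = v₀ → s.Followed ρ → s'.Followed ρ' →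
      ρ.Agree k ρ' → G.owner (ρ.1 k) = i → ρ.1 (k + 1) ≠ ρ'.1 (k + 1) →
      G.payoff i ρ ≤ G.payoff i ρ') : G.WeakDom v₀ s s' := by
  intro τ
  by_cases hne : (τ.join s).outcome v₀ = (τ.join s').outcome v₀
  · rw [Game.pay, Game.pay, hne]
  · obtain ⟨k, e, hk, h1⟩ := exists_divergence s s' τ hne
    exact h _ _ k rfl (τ.followed_outcome s v₀) (τ.followed_outcome s' v₀) e hk h1

theorem WeakDom.refl (s : G.Strategy i) : G.WeakDom v₀ s s := fun _ => le_rfl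

theorem WeakDom.trans {s s' s'' : G.Strategy i} (h : G.WeakDom v₀ s s')
    (h' : G.WeakDom v₀ s' s'') : G.WeakDom v₀ s s'' :=
  fun τ => (h τ).trans (h' τ)

end Game

/-! ### The antagonistic value of a vertex -/

section Value

variable {V : Type*} {own : V → Prop} {E : V → V → Prop} {L : Set V} {n : V → ℤ}

open Classical in
/-- The payoff of a path in a generalised safety/reachability game: the value of the leaf
which is reached, and `0` if none is. -/
noncomputable def leafPay (L : Set V) (n : V → ℤ) (ρ : ℕ → V) : ℤ :=
  if h : ∃ k, ρ k ∈ L then n (ρ (Nat.find h)) else 0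

theorem leafPay_of_forall_notMem {ρ : ℕ → V} (h : ∀ k, ρ k ∉ L) : leafPay L n ρ = 0 := by
  rw [leafPay, dif_neg (by simpa using h)]

theorem leafPay_neg (ρ : ℕ → V) : leafPay L (fun v => -n v) ρ = -leafPay L n ρ := by
  unfold leafPay
  split_ifs <;> simp

theorem eq_of_mem_leaf (hL : ∀ l ∈ L, ∀ w, E l w ↔ w = l) {ρ : ℕ → V}
    (hρ : ∀ k, E (ρ k) (ρ (k + 1))) {k : ℕ} (hk : ρ k ∈ L) {m : ℕ} (hm : k ≤ m) :
    ρ m = ρ k := by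
  induction m, hm using Nat.le_induction with
  | base => rfl
  | succ m hm ih =>
    have h1 := hρ m
    rw [ih] at h1
    exact (hL _ hk _).1 h1

theorem leafPay_of_mem (hL : ∀ l ∈ L, ∀ w, E l w ↔ w = l) {ρ : ℕ → V}
    (hρ : ∀ k, E (ρ k) (ρ (k + 1))) {k : ℕ} (hk : ρ k ∈ L) : leafPay L n ρ = n (ρ k) := by
  classical
  have h : ∃ k, ρ k ∈ L := ⟨k, hk⟩
  rw [leafPay, dif_pos h]
  rw [eq_of_mem_leaf hL hρ (Nat.find_spec h) (Nat.find_min' h hk)]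

theorem leafPay_tail (hL : ∀ l ∈ L, ∀ w, E l w ↔ w = l) {ρ : ℕ → V}
    (hρ : ∀ k, E (ρ k) (ρ (k + 1))) (m : ℕ) :
    leafPay L n (fun k => ρ (m + k)) = leafPay L n ρ := by
  by_cases h : ∃ k, ρ k ∈ L
  · obtain ⟨k, hk⟩ := h
    have h1 := eq_of_mem_leaf hL hρ hk (Nat.le_add_left k m)
    rw [leafPay_of_mem hL hρ hk, leafPay_of_mem (k := k) hL (fun k => hρ (m + k)) (by rwa [h1]), h1]
  · push Not at h
    rw [leafPay_of_forall_notMem h, leafPay_of_forall_notMem fun k => h (m + k)]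

/-- A path along which `b` never decreases, and along which some ranking decreases as long as `b`
is positive, pays at least the initial value of `b`. -/
theorem le_leafPay {ι : Type*} [Preorder ι] [WellFoundedLT ι]
    (hL : ∀ l ∈ L, ∀ w, E l w ↔ w = l) {b : V → ℤ} (hb : ∀ l ∈ L, b l = n l)
    {ρ : ℕ → V} (hρ : ∀ k, E (ρ k) (ρ (k + 1))) (hmono : ∀ k, b (ρ k) ≤ b (ρ (k + 1)))
    (f : ℕ → ι) (hf : ∀ k, 0 < b (ρ k) → ρ k ∉ L → f (k + 1) < f k) :
    b (ρ 0) ≤ leafPay L n ρ := by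
  have hm : Monotone fun k => b (ρ k) := monotone_nat_of_le_succ hmono
  by_cases h : ∃ k, ρ k ∈ L
  · obtain ⟨k, hk⟩ := h
    rw [leafPay_of_mem hL hρ hk, ← hb _ hk]
    exact hm (Nat.zero_le k)
  · push Not at h
    rw [leafPay_of_forall_notMem h]
    by_contra! hpos
    exact not_strictAnti_of_wellFoundedLT f (strictAnti_nat_of_succ_lt fun k =>
      hf k (hpos.trans_le (hm (Nat.zero_le k))) (h k))

/-- `u k v` is the value, at `v`, of the game stopped after `k` moves, with payoff `0` when no leaf
has been reached. The vertices in `own` are those of the maximizing player. -/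
structure IsValueIteration (own : V → Prop) (E : V → V → Prop) (L : Set V) (u : ℕ → V → ℤ) :
    Prop where
  leaf : ∀ l ∈ L, ∀ w, E l w ↔ w = l
  zero : ∀ v ∉ L, u 0 v = 0
  own_mem : ∀ k v, own v → ∃ w, E v w ∧ u (k + 1) v = u k w
  own_le : ∀ k v w, own v → E v w → u k w ≤ u (k + 1) v
  opp_mem : ∀ k v, ¬ own v → ∃ w, E v w ∧ u (k + 1) v = u k w
  opp_le : ∀ k v w, ¬ own v → E v w → u (k + 1) v ≤ u k w

open Classical in
theorem exists_isValueIteration [Finite V] (hE : ∀ v, ∃ w, E v w)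
    (hL : ∀ l ∈ L, ∀ w, E l w ↔ w = l) (hn : ∀ v ∉ L, n v = 0) :
    ∃ u, u 0 = n ∧ IsValueIteration own E L u := by
  let next (u : V → ℤ) (v : V) : ℤ :=
    if own v then sSup (u '' {w | E v w}) else sInf (u '' {w | E v w})
  have hfin : ∀ (u : V → ℤ) v, (u '' {w | E v w}).Finite := fun u v => Set.toFinite _
  have hne : ∀ (u : V → ℤ) v, (u '' {w | E v w}).Nonempty := fun u v => by
    obtain ⟨w, hw⟩ := hE v
    exact ⟨u w, w, hw, rfl⟩
  refine ⟨fun k => Nat.rec n (fun _ u => next u) k, rfl, hL, hn, ?_, ?_, ?_, ?_⟩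
  · intro k v hv
    obtain ⟨w, hw, h⟩ := (hne (Nat.rec n (fun _ u => next u) k) v).csSup_mem (hfin _ v)
    exact ⟨w, hw, by simp only [next, if_pos hv]; exact h.symm⟩
  · intro k v w hv hw
    simp only [next, if_pos hv]
    exact le_csSup (hfin _ v).bddAbove ⟨w, hw, rfl⟩
  · intro k v hv
    obtain ⟨w, hw, h⟩ := (hne (Nat.rec n (fun _ u => next u) k) v).csInf_mem (hfin _ v)
    exact ⟨w, hw, by simp only [next, if_neg hv]; exact h.symm⟩
  · intro k v w hv hw
    simp only [next, if_neg hv]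
    exact csInf_le (hfin _ v).bddBelow ⟨w, hw, rfl⟩

namespace IsValueIteration

variable {u : ℕ → V → ℤ}

theorem dual (h : IsValueIteration own E L u) :
    IsValueIteration (fun v => ¬ own v) E L (fun k v => -u k v) where
  leaf := h.leaf
  zero v hv := by simp [h.zero v hv]
  own_mem k v hv := by simpa using h.opp_mem k v hv
  own_le k v w hv hw := by simpa using h.opp_le k v w hv hw
  opp_mem k v hv := by simpa using h.own_mem k v (not_not.1 hv)
  opp_le k v w hv hw := by simpa using h.own_le k v w (not_not.1 hv) hw

theorem exists_succ_eq (h : IsValueIteration own E L u) (k : ℕ) (v : V) :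
    ∃ w, E v w ∧ u (k + 1) v = u k w := by
  by_cases hv : own v
  · exact h.own_mem k v hv
  · exact h.opp_mem k v hv

theorem leaf_eq (h : IsValueIteration own E L u) {l : V} (hl : l ∈ L) (k : ℕ) :
    u k l = u 0 l := by
  induction k with
  | zero => rfl
  | succ k ih =>
    obtain ⟨w, hw, e⟩ := h.exists_succ_eq k l
    rw [e, (h.leaf l hl w).1 hw, ih]

/-- The positive part of a value iteration never decreases. -/
theorem monotone_posPart (h : IsValueIteration own E L u) (v : V) :
    Monotone fun k => max (u k v) 0 := by
  refine monotone_nat_of_le_succ fun k => ?_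
  induction k generalizing v with
  | zero =>
    by_cases hv : v ∈ L
    · rw [h.leaf_eq hv 1]
    · rw [h.zero v hv]; simp
  | succ k ih =>
    by_cases hv : own v
    · obtain ⟨w, hw, e⟩ := h.own_mem k v hv
      rw [e]
      exact (ih w).trans (max_le_max_right 0 (h.own_le (k + 1) v w hv hw))
    · obtain ⟨w, hw, e⟩ := h.opp_mem (k + 1) v hv
      rw [e]
      exact (max_le_max_right 0 (h.opp_le k v w hv hw)).trans (ih w)

theorem exists_posPart_stable [Finite V] (h : IsValueIteration own E L u) :
    ∃ K, ∀ k ≥ K, ∀ v, max (u k v) 0 = max (u K v) 0 := by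
  let S : Set ℤ := Set.range fun v => max (u 0 v) 0
  have hS : ∀ k v, max (u k v) 0 ∈ S := by
    intro k
    induction k with
    | zero => exact fun v => ⟨v, rfl⟩
    | succ k ih =>
      intro v
      obtain ⟨w, -, e⟩ := h.exists_succ_eq k v
      rw [e]
      exact ih w
  have : Finite S := Set.finite_range _
  let p : ℕ →o (V → S) :=
    ⟨fun k v => ⟨max (u k v) 0, hS k v⟩, fun k l hkl v => h.monotone_posPart v hkl⟩
  obtain ⟨K, hK⟩ := WellFoundedGT.monotone_chain_condition p
  exact ⟨K, fun k hk v => (congrArg Subtype.val (congrFun (hK k hk) v)).symm⟩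

theorem exists_stable [Finite V] (h : IsValueIteration own E L u) :
    ∃ K, ∀ k ≥ K, u k = u K := by
  obtain ⟨K, hK⟩ := h.exists_posPart_stable
  obtain ⟨K', hK'⟩ := h.dual.exists_posPart_stable
  refine ⟨max K K', fun k hk => funext fun v => ?_⟩
  have h1 := hK k (by omega) v
  have h2 := hK (max K K') (by omega) v
  have h3 := hK' k (by omega) v
  have h4 := hK' (max K K') (by omega) v
  omega

/-- With respect to the limit `u K` of a value iteration, the maximizing player has a positional
strategy which preserves the value and which, as long as the value is positive, decreases a
ranking which the opponents cannot increase. -/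
theorem exists_ranking [Finite V] (h : IsValueIteration own E L u) {K : ℕ}
    (hK : ∀ k ≥ K, u k = u K) :
    ∃ (μ : V → ℕ ×ₗ ℕ) (α : V → V), (∀ v, E v (α v)) ∧ (∀ v, own v → u K (α v) = u K v) ∧
      (∀ v, own v → 0 < u K v → v ∉ L → μ (α v) < μ v) ∧
      ∀ v w, ¬ own v → 0 < u K v → v ∉ L → E v w → μ w < μ v := by
  classical
  have hposle : ∀ k v, max (u k v) 0 ≤ max (u K v) 0 := by
    intro k v
    have h1 := h.monotone_posPart v (le_max_left k K)
    simpa only [hK (max k K) (le_max_right _ _)] using h1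
  have hown : ∀ v w, own v → E v w → u K w ≤ u K v := fun v w hv hw => by
    have h1 := h.own_le K v w hv hw
    rwa [hK (K + 1) (by omega)] at h1
  have hopp : ∀ v w, ¬ own v → E v w → u K v ≤ u K w := fun v w hv hw => by
    have h1 := h.opp_le K v w hv hw
    rwa [hK (K + 1) (by omega)] at h1
  -- the number of moves after which the positive part of the value is reached
  let κ : V → ℕ := fun v => sInf {k | max (u k v) 0 = max (u K v) 0}
  have hκ : ∀ v, max (u (κ v) v) 0 = max (u K v) 0 := fun v =>
    Nat.sInf_mem (s := {k | max (u k v) 0 = max (u K v) 0}) ⟨K, rfl⟩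
  have hκle : ∀ v k, max (u k v) 0 = max (u K v) 0 → κ v ≤ k := fun v k hk =>
    Nat.sInf_le (s := {k | max (u k v) 0 = max (u K v) 0}) hk
  have hκpos : ∀ v, 0 < u K v → v ∉ L → ∃ k, κ v = k + 1 ∧ u (k + 1) v = u K v := by
    intro v hv hvL
    have h1 := hκ v
    rcases hk : κ v with _ | k
    · rw [hk, h.zero v hvL] at h1
      omega
    · rw [hk] at h1
      exact ⟨k, rfl, by omega⟩
  have hex : ∀ v, ∃ w, E v w ∧ (own v → u K w = u K v) ∧
      (own v → 0 < u K v → v ∉ L → κ w < κ v) := by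
    intro v
    by_cases hc : own v ∧ 0 < u K v ∧ v ∉ L
    · obtain ⟨hv, hpos, hvL⟩ := hc
      obtain ⟨k, hk, e⟩ := hκpos v hpos hvL
      obtain ⟨w, hw, e'⟩ := h.own_mem k v hv
      have h1 := hown v w hv hw
      have h2 := hposle k w
      have h3 := hκle w k (by omega)
      exact ⟨w, hw, fun _ => by omega, fun _ _ _ => by omega⟩
    · obtain ⟨w, hw, e⟩ := h.exists_succ_eq K v
      refine ⟨w, hw, fun _ => ?_, fun h1 h2 h3 => absurd ⟨h1, h2, h3⟩ hc⟩
      rw [← e, hK (K + 1) (by omega)]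
  choose α hα1 hα2 hα3 using hex
  obtain ⟨R, hR⟩ := (Set.finite_range (u K)).bddAbove
  have hR' : ∀ v, u K v ≤ R := fun v => hR ⟨v, rfl⟩
  refine ⟨fun v => toLex ((R - u K v).toNat, κ v), α, hα1, hα2, ?_, ?_⟩
  · intro v hv hpos hvL
    rw [Prod.Lex.toLex_lt_toLex]
    right
    exact ⟨by rw [hα2 v hv], hα3 v hv hpos hvL⟩
  · intro v w hv hpos hvL hw
    rw [Prod.Lex.toLex_lt_toLex]
    have h1 := hopp v w hv hw
    have h2 := hR' w
    obtain ⟨k, hk, e⟩ := hκpos v hpos hvL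
    have h3 := h.opp_le k v w hv hw
    have h4 := hposle k w
    rcases h1.lt_or_eq with h1 | h1
    · left
      change (R - u K w).toNat < (R - u K v).toNat
      omega
    · right
      have h5 := hκle w k (by omega)
      refine ⟨by rw [h1], ?_⟩
      change κ w < κ v
      omega

end IsValueIteration

/-- `a` gives the antagonistic values of the vertices. The positional strategy `α` of the
maximizing player is optimal, and so is `ω` for the opponents; `μ` is a ranking which proves that a
positive value is eventually obtained. -/
structure IsValuation (own : V → Prop) (E : V → V → Prop) (L : Set V) (n : V → ℤ)
    (a : V → ℤ) (μ : V → ℕ ×ₗ ℕ) (α ω : V → V) : Prop where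
  leaf : ∀ l ∈ L, ∀ w, E l w ↔ w = l
  eq_leaf : ∀ l ∈ L, a l = n l
  own_le : ∀ v w, own v → E v w → a w ≤ a v
  opp_le : ∀ v w, ¬ own v → E v w → a v ≤ a w
  edge : ∀ v, E v (α v)
  own_eq : ∀ v, own v → a (α v) = a v
  own_lt : ∀ v, own v → 0 < a v → v ∉ L → μ (α v) < μ v
  opp_lt : ∀ v w, ¬ own v → 0 < a v → v ∉ L → E v w → μ w < μ v
  edge_opp : ∀ v, E v (ω v)
  leafPay_le : ∀ (ρ : ℕ → V) (m : ℕ), (∀ k, E (ρ k) (ρ (k + 1))) →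
    (∀ k ≥ m, ¬ own (ρ k) → ρ (k + 1) = ω (ρ k)) → leafPay L n ρ ≤ a (ρ m)

theorem exists_isValuation [Finite V] (hE : ∀ v, ∃ w, E v w)
    (hL : ∀ l ∈ L, ∀ w, E l w ↔ w = l) (hn : ∀ v ∉ L, n v = 0) :
    ∃ (a : V → ℤ) (μ : V → ℕ ×ₗ ℕ) (α ω : V → V), IsValuation own E L n a μ α ω := by
  obtain ⟨u, h0, h⟩ := exists_isValueIteration (own := own) hE hL hn
  obtain ⟨K, hK⟩ := h.exists_stable
  obtain ⟨μ, α, h1, h2, h3, h4⟩ := h.exists_ranking hK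
  obtain ⟨ν, ω, h5, h6, h7, h8⟩ := h.dual.exists_ranking (K := K)
    (fun k hk => by funext v; rw [hK k hk])
  have hle : ∀ l ∈ L, u K l = n l := fun l hl => by rw [h.leaf_eq hl, h0]
  have hown : ∀ v w, own v → E v w → u K w ≤ u K v := fun v w hv hw => by
    have h1 := h.own_le K v w hv hw
    rwa [hK (K + 1) (by omega)] at h1
  refine ⟨u K, μ, α, ω, hL, hle, hown, ?_, h1, h2, h3, h4, h5, ?_⟩
  · intro v w hv hw
    have h1 := h.opp_le K v w hv hw
    rwa [hK (K + 1) (by omega)] at h1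
  · intro ρ m hρ hω
    have key := le_leafPay (b := fun v => -u K v) (n := fun v => -n v)
      (ρ := fun k => ρ (m + k)) hL
      (fun l hl => by simp [hle l hl]) (fun k => hρ (m + k)) (fun k => ?_)
      (fun k => ν (ρ (m + k))) (fun k hpos hk => ?_)
    · rw [leafPay_tail hL hρ, leafPay_neg] at key
      simpa using key
    · by_cases hv : own (ρ (m + k))
      · exact neg_le_neg (hown _ _ hv (hρ (m + k)))
      · rw [← add_assoc, hω (m + k) (by omega) hv]
        exact (h6 _ hv).ge
    · by_cases hv : own (ρ (m + k))
      · exact h8 _ _ (not_not.2 hv) hpos hk (hρ (m + k))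
      · change ν (ρ (m + k + 1)) < _
        rw [hω (m + k) (by omega) hv]
        exact h7 _ hv hpos hk

end Value

namespace Arena

variable {P V : Type*} {A : Arena P V} {i : P}

/-! ### Cutting and pasting outcomes -/

/-- The outcome `ρ` without its first `m` vertices. -/
def Outcome.tail (ρ : A.Outcome) (m : ℕ) : A.Outcome :=
  ⟨fun k => ρ.1 (m + k), fun k => ρ.2 (m + k)⟩

/-- The outcome which follows `ρ` up to its vertex number `k`, and then `π`. -/
def Outcome.splice (ρ : A.Outcome) (k : ℕ) (π : A.Outcome) (h : π.1 0 = ρ.1 k) : A.Outcome :=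
  ⟨fun j => if j ≤ k then ρ.1 j else π.1 (j - k), fun j => by
    beta_reduce
    rcases lt_trichotomy j k with hj | rfl | hj
    · rw [if_pos hj.le, if_pos (by omega)]; exact ρ.2 j
    · rw [if_pos le_rfl, if_neg (by omega), ← h, Nat.add_sub_cancel_left]; exact π.2 0
    · rw [if_neg (by omega), if_neg (by omega), Nat.sub_add_comm hj.le]; exact π.2 (j - k)⟩

theorem Outcome.agree_splice (ρ : A.Outcome) (k : ℕ) (π : A.Outcome) (h : π.1 0 = ρ.1 k) :
    ρ.Agree k (ρ.splice k π h) :=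
  fun _ hj => (if_pos hj).symm

theorem Outcome.splice_add (ρ : A.Outcome) (k : ℕ) (π : A.Outcome) (h : π.1 0 = ρ.1 k) (j : ℕ) :
    (ρ.splice k π h).1 (k + j) = π.1 j := by
  change (if k + j ≤ k then ρ.1 (k + j) else π.1 (k + j - k)) = π.1 j
  rcases j with _ | j
  · rw [if_pos (by omega)]; exact h.symm
  · rw [if_neg (by omega), Nat.add_sub_cancel_left]

theorem Outcome.tail_splice (ρ : A.Outcome) (k : ℕ) (π : A.Outcome) (h : π.1 0 = ρ.1 k) :
    (ρ.splice k π h).tail k = π :=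
  Subtype.ext (funext fun j => ρ.splice_add k π h j)

/-- The outcome `π` preceded by the vertex `v`. -/
def Outcome.cons (v : V) (π : A.Outcome) (h : A.Edge v (π.1 0)) : A.Outcome :=
  ⟨fun k => Nat.casesOn k v fun k => π.1 k, fun k => by
    rcases k with _ | k
    · exact h
    · exact π.2 k⟩

/-- The path obtained by iterating a function which selects a successor of each vertex. -/
def Outcome.orbit (f : V → V) (hf : ∀ v, A.Edge v (f v)) (v : V) : A.Outcome :=
  ⟨fun k => f^[k] v, fun k => by
    beta_reduce; rw [Function.iterate_succ_apply']; exact hf _⟩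

theorem Outcome.orbit_succ (f : V → V) (hf : ∀ v, A.Edge v (f v)) (v : V) (k : ℕ) :
    (Outcome.orbit f hf v).1 (k + 1) = f ((Outcome.orbit f hf v).1 k) :=
  Function.iterate_succ_apply' f k v

/-! ### Strategies realized by machines -/

variable (A)

/-- A machine with an arbitrary set of states, which suggests a move at every vertex, whoever
owns it. Mealy automata and automata with a counter are instances. -/
structure Machine where
  S : Type
  upd : S → V → S
  act : S → V → V
  legal : ∀ s v, A.Edge v (act s v)

variable {A}

namespace Machine

variable (T : A.Machine)

/-- The state of the machine, started in `s`, when it reads vertex number `k` of the path. -/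
def run (s : T.S) (ρ : ℕ → V) : ℕ → T.S
  | 0 => s
  | k + 1 => T.upd (run s ρ k) (ρ k)

theorem run_congr (s : T.S) {ρ ρ' : ℕ → V} {k : ℕ} (h : ∀ j < k, ρ j = ρ' j) :
    T.run s ρ k = T.run s ρ' k := by
  induction k with
  | zero => rfl
  | succ k ih =>
    change T.upd _ _ = T.upd _ _
    rw [ih fun j hj => h j (by omega), h k (by omega)]

theorem run_agree (s : T.S) {ρ ρ' : A.Outcome} {k : ℕ} (h : ρ.Agree k ρ') :
    T.run s ρ.1 k = T.run s ρ'.1 k :=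
  T.run_congr s fun j hj => h j hj.le

theorem run_tail (s : T.S) (ρ : A.Outcome) (m k : ℕ) :
    T.run (T.run s ρ.1 m) (ρ.tail m).1 k = T.run s ρ.1 (m + k) := by
  induction k with
  | zero => rfl
  | succ k ih =>
    change T.upd _ _ = T.upd _ _
    rw [ih]; rfl

theorem run_eq_foldl (s : T.S) (ρ : ℕ → V) (k : ℕ) :
    ((List.range k).map ρ).foldl T.upd s = T.run s ρ k := by
  induction k with
  | zero => rfl
  | succ k ih =>
    rw [List.range_succ, List.map_append, List.foldl_append, ih]
    rfl

/-- The moves of player `i` along `ρ` are those of the machine, for the first `n` moves. -/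
def FollowedUpto (i : P) (s : T.S) (ρ : A.Outcome) (n : ℕ) : Prop :=
  ∀ k < n, A.owner (ρ.1 k) = i → ρ.1 (k + 1) = T.act (T.run s ρ.1 k) (ρ.1 k)

/-- The moves of player `i` along `ρ` are those of the machine. -/
def Followed (i : P) (s : T.S) (ρ : A.Outcome) : Prop :=
  ∀ k, A.owner (ρ.1 k) = i → ρ.1 (k + 1) = T.act (T.run s ρ.1 k) (ρ.1 k)

/-- The strategy realized by a machine started in the state `s`. -/
def strategy (i : P) (s : T.S) : A.Strategy i where
  move h _ := T.act (h.past.foldl T.upd s) h.last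
  legal _ _ := T.legal _ _

theorem followedUpto_strategy {s : T.S} {ρ : A.Outcome} {n : ℕ} :
    (T.strategy i s).FollowedUpto ρ n ↔ T.FollowedUpto i s ρ n := by
  unfold Strategy.FollowedUpto FollowedUpto
  refine forall₃_congr fun k _ _ => ?_
  rw [← T.run_eq_foldl]; rfl

theorem followed_strategy {s : T.S} {ρ : A.Outcome} :
    (T.strategy i s).Followed ρ ↔ T.Followed i s ρ := by
  unfold Strategy.Followed Followed
  refine forall₂_congr fun k _ => ?_
  rw [← T.run_eq_foldl]; rfl

variable {T}

theorem Followed.upto {s : T.S} {ρ : A.Outcome} (h : T.Followed i s ρ) (n : ℕ) :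
    T.FollowedUpto i s ρ n :=
  fun k _ => h k

theorem FollowedUpto.congr {s : T.S} {ρ ρ' : A.Outcome} {n : ℕ}
    (h : T.FollowedUpto i s ρ n) (e : ρ.Agree n ρ') : T.FollowedUpto i s ρ' n :=
  T.followedUpto_strategy.1 ((T.followedUpto_strategy.2 h).congr e)

theorem Followed.tail {s : T.S} {ρ : A.Outcome} (h : T.Followed i s ρ) (m : ℕ) :
    T.Followed i (T.run s ρ.1 m) (ρ.tail m) := by
  intro k hk
  rw [T.run_tail]
  exact h (m + k) hk

theorem FollowedUpto.splice {s : T.S} {ρ : A.Outcome} {k : ℕ} (h : T.FollowedUpto i s ρ k)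
    {π : A.Outcome} (hπ : T.Followed i (T.run s ρ.1 k) π) (e : π.1 0 = ρ.1 k) :
    T.Followed i s (ρ.splice k π e) := by
  intro j hj
  have hag := ρ.agree_splice k π e
  rcases lt_or_ge j k with hjk | hjk
  · exact h.congr hag j hjk hj
  · obtain ⟨j, rfl⟩ := Nat.exists_eq_add_of_le hjk
    have h1 := T.run_tail s (ρ.splice k π e) k j
    rw [Outcome.tail_splice, ← T.run_agree s hag] at h1
    rw [add_assoc, ρ.splice_add, ← h1, ρ.splice_add]
    rw [ρ.splice_add] at hj
    exact hπ j hj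

theorem Followed.cons {s : T.S} {v : V} {π : A.Outcome} (hπ : T.Followed i (T.upd s v) π)
    (h : A.Edge v (π.1 0)) (hv : A.owner v = i → π.1 0 = T.act s v) :
    T.Followed i s (π.cons v h) := by
  intro k hk
  rcases k with _ | k
  · exact hv hk
  · have h1 : T.run s (π.cons v h).1 (k + 1) = T.run (T.upd s v) π.1 k := by
      have := (T.run_tail s (π.cons v h) 1 k).symm
      rw [add_comm] at this
      rw [this]
      congr 1
      funext j
      change (π.cons v h).1 (1 + j) = π.1 j
      rw [add_comm]
      rfl
    rw [h1]
    exact hπ k hk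

variable (T) in
theorem exists_followed (i : P) (s : T.S) (v : V) : ∃ ρ : A.Outcome, ρ.1 0 = v ∧ T.Followed i s ρ := by
  let step : T.S × V → T.S × V := fun x => (T.upd x.1 x.2, T.act x.1 x.2)
  have hs : ∀ k, step^[k + 1] (s, v) = step (step^[k] (s, v)) :=
    fun k => Function.iterate_succ_apply' step k (s, v)
  let ρ : A.Outcome := ⟨fun k => (step^[k] (s, v)).2, fun k => by
    beta_reduce; rw [hs]; exact T.legal _ _⟩
  have hr : ∀ k, T.run s ρ.1 k = (step^[k] (s, v)).1 := by
    intro k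
    induction k with
    | zero => rfl
    | succ k ih =>
      change T.upd _ _ = _
      rw [ih, hs]
  refine ⟨ρ, rfl, fun k _ => ?_⟩
  rw [hr]
  change (step^[k + 1] (s, v)).2 = _
  rw [hs]

end Machine

open Classical in
/-- A Mealy automaton seen as a machine: its moves at the vertices of the opponents are
irrelevant. -/
noncomputable def Mealy.toMachine (𝓜 : A.Mealy i) : A.Machine where
  S := 𝓜.M
  upd := 𝓜.update
  act m v := if hv : A.owner v = i then 𝓜.choose m v hv else (A.exists_succ v).choose
  legal m v := by
    split_ifs with hv
    · exact 𝓜.legal m v hv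
    · exact (A.exists_succ v).choose_spec

theorem Mealy.strategy_toMachine (𝓜 : A.Mealy i) :
    𝓜.toMachine.strategy i 𝓜.init = 𝓜.strategy := by
  ext h hi
  exact dif_pos hi

end Arena

/-! ### Vertices where the opponents may help -/

/-- The data of a generalised safety/reachability game for player `i`: the leaves and their
payoffs, with the antagonistic values and optimal positional strategies. -/
structure ValuedArena {P V : Type*} (A : Arena P V) (i : P) where
  L : Set V
  n : V → ℤ
  a : V → ℤ
  μ : V → ℕ ×ₗ ℕ
  α : V → V
  ω : V → V
  isVal : IsValuation (fun v => A.owner v = i) A.Edge L n a μ α ω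

namespace ValuedArena

variable {P V : Type*} {A : Arena P V} {i : P} (W : ValuedArena A i)

/-- The payoff of an outcome for player `i`. -/
noncomputable def pay (ρ : A.Outcome) : ℤ := leafPay W.L W.n ρ.1

theorem pay_tail (ρ : A.Outcome) (m : ℕ) : W.pay (ρ.tail m) = W.pay ρ :=
  leafPay_tail W.isVal.leaf ρ.2 m

theorem pay_splice (ρ : A.Outcome) (k : ℕ) (π : A.Outcome) (h : π.1 0 = ρ.1 k) :
    W.pay (ρ.splice k π h) = W.pay π := by
  rw [← W.pay_tail _ k, Outcome.tail_splice]

theorem pay_cons (v : V) (π : A.Outcome) (h : A.Edge v (π.1 0)) :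
    W.pay (π.cons v h) = W.pay π := by
  rw [← W.pay_tail _ 1]
  congr 1
  refine Subtype.ext (funext fun j => ?_)
  change (π.cons v h).1 (1 + j) = π.1 j
  rw [add_comm]
  rfl

theorem exists_mem_leaf_of_pay_ne_zero {ρ : A.Outcome} (h : W.pay ρ ≠ 0) : ∃ k, ρ.1 k ∈ W.L := by
  by_contra! hcon
  exact h (leafPay_of_forall_notMem hcon)

theorem pay_of_mem_leaf {ρ : A.Outcome} {k : ℕ} (hk : ρ.1 k ∈ W.L) : W.pay ρ = W.a (ρ.1 k) := by
  rw [W.isVal.eq_leaf _ hk]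
  exact leafPay_of_mem W.isVal.leaf ρ.2 hk

/-- A path from `v` on which the values stay above that of `v`, and which pays more than this
value. -/
def IsHopePath (v : V) (ρ : A.Outcome) : Prop :=
  ρ.1 0 = v ∧ (∀ k, W.a v ≤ W.a (ρ.1 k)) ∧ W.a v < W.pay ρ

/-- With the help of the opponents, player `i` may get more than the value of `v` without ever
putting this value at risk. -/
def Hopeful (v : V) : Prop := ∃ ρ, W.IsHopePath v ρ

/-- The least number of moves on a hope path from `v` to a vertex of larger value, when the value of
`v` is not negative. For negative values, there may be no such vertex, and this is `0`. -/
noncomputable def dist (v : V) : ℕ :=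
  sInf {k | ∃ ρ, W.IsHopePath v ρ ∧ (0 ≤ W.a v → W.a v < W.a (ρ.1 k))}

variable {W}

theorem Hopeful.exists_dist {v : V} (h : W.Hopeful v) :
    ∃ ρ, W.IsHopePath v ρ ∧ (0 ≤ W.a v → W.a v < W.a (ρ.1 (W.dist v))) := by
  refine Nat.sInf_mem (s := {k | ∃ ρ, W.IsHopePath v ρ ∧ (0 ≤ W.a v → W.a v < W.a (ρ.1 k))}) ?_
  obtain ⟨ρ, hρ⟩ := h
  by_cases h0 : 0 ≤ W.a v
  · obtain ⟨k, hk⟩ := W.exists_mem_leaf_of_pay_ne_zero (h0.trans_lt hρ.2.2).ne'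
    exact ⟨k, ρ, hρ, fun _ => by rw [← W.pay_of_mem_leaf hk]; exact hρ.2.2⟩
  · exact ⟨0, ρ, hρ, fun h => absurd h h0⟩

theorem Hopeful.notMem {v : V} (h : W.Hopeful v) : v ∉ W.L := by
  obtain ⟨ρ, rfl, -, h1⟩ := h
  intro hL
  rw [W.pay_of_mem_leaf hL] at h1
  exact lt_irrefl _ h1

theorem Hopeful.exists_next {v : V} (h : W.Hopeful v) :
    ∃ w, A.Edge v w ∧ W.a v ≤ W.a w ∧
      (W.a w = W.a v → W.Hopeful w ∧ (0 ≤ W.a v → W.dist w < W.dist v)) := by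
  obtain ⟨ρ, hρ, hd⟩ := h.exists_dist
  refine ⟨ρ.1 1, by have := ρ.2 0; rwa [hρ.1] at this, hρ.2.1 1, fun e => ?_⟩
  have hp : W.IsHopePath (ρ.1 1) (ρ.tail 1) := by
    refine ⟨rfl, fun k => ?_, ?_⟩
    · rw [e]; exact hρ.2.1 (1 + k)
    · rw [e, W.pay_tail]; exact hρ.2.2
  refine ⟨⟨_, hp⟩, fun h0 => ?_⟩
  have h1 := hd h0
  rcases hk : W.dist v with _ | k
  · rw [hk, hρ.1] at h1
    exact absurd h1 (lt_irrefl _)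
  · refine Nat.lt_succ_of_le (Nat.sInf_le ⟨ρ.tail 1, hp, fun _ => ?_⟩)
    rw [e]
    change _ < W.a (ρ.1 (1 + k))
    rw [add_comm, ← hk]
    exact h1

variable (W)

open Classical in
/-- At a hopeful vertex, the next vertex on a hope path that realizes `dist`; elsewhere, the
choice is irrelevant. -/
noncomputable def coop (v : V) : V := if h : W.Hopeful v then h.exists_next.choose else W.α v

theorem coop_spec {v : V} (h : W.Hopeful v) :
    W.a v ≤ W.a (W.coop v) ∧ (W.a (W.coop v) = W.a v →
      W.Hopeful (W.coop v) ∧ (0 ≤ W.a v → W.dist (W.coop v) < W.dist v)) := by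
  rw [coop, dif_pos h]
  exact h.exists_next.choose_spec.2

theorem edge_coop (v : V) : A.Edge v (W.coop v) := by
  unfold coop
  split_ifs with h
  · exact h.exists_next.choose_spec.1
  · exact W.isVal.edge v

open Classical in
/-- A positional strategy which guarantees the value of each vertex. For values at most `0`,
where the value is guaranteed as long as it does not decrease, it always counts on the help of the
opponents. -/
noncomputable def base (v : V) : V := if W.a v ≤ 0 ∧ W.Hopeful v then W.coop v else W.α v

theorem edge_base (v : V) : A.Edge v (W.base v) := by
  unfold base
  split_ifs
  · exact W.edge_coop v
  · exact W.isVal.edge v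

theorem base_of_pos {v : V} (h : 0 < W.a v) : W.base v = W.α v :=
  if_neg fun h' => absurd h'.1 h.not_ge

theorem le_base (v : V) : W.a v ≤ W.a (W.base v) := by
  unfold base
  split_ifs with h
  · exact (W.coop_spec h.2).1
  · by_cases hv : A.owner v = i
    · exact (W.isVal.own_eq v hv).ge
    · exact W.isVal.opp_le v _ hv (W.isVal.edge v)

/-- The moves of player `i` along `ρ` are those of `base`. -/
def FollowsBase (ρ : A.Outcome) : Prop :=
  ∀ k, A.owner (ρ.1 k) = i → ρ.1 (k + 1) = W.base (ρ.1 k)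

variable {W}

theorem FollowsBase.tail {ρ : A.Outcome} (h : W.FollowsBase ρ) (m : ℕ) :
    W.FollowsBase (ρ.tail m) :=
  fun k hk => h (m + k) hk

theorem FollowsBase.le_succ {ρ : A.Outcome} (h : W.FollowsBase ρ) (k : ℕ) :
    W.a (ρ.1 k) ≤ W.a (ρ.1 (k + 1)) := by
  by_cases hv : A.owner (ρ.1 k) = i
  · rw [h k hv]; exact W.le_base _
  · exact W.isVal.opp_le _ _ hv (ρ.2 k)

theorem FollowsBase.le_pay {ρ : A.Outcome} (h : W.FollowsBase ρ) (k : ℕ) :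
    W.a (ρ.1 k) ≤ W.pay ρ := by
  rw [← W.pay_tail ρ k]
  refine le_leafPay (b := W.a) W.isVal.leaf W.isVal.eq_leaf (ρ.tail k).2
    (fun j => (h.tail k).le_succ j) (fun j => W.μ ((ρ.tail k).1 j)) fun j hpos hL => ?_
  by_cases hv : A.owner ((ρ.tail k).1 j) = i
  · rw [h.tail k j hv, W.base_of_pos hpos]
    exact W.isVal.own_lt _ hv hpos hL
  · exact W.isVal.opp_lt _ _ hv hpos hL ((ρ.tail k).2 j)

variable (W)

/-- Against `base`, the opponents may let player `i` get more than the value of `v`. -/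
def Promising (v : V) : Prop := ∃ ρ, ρ.1 0 = v ∧ W.FollowsBase ρ ∧ W.a v < W.pay ρ

variable {W}

theorem Hopeful.promising {v : V} (h : W.Hopeful v) (h0 : W.a v ≤ 0) : W.Promising v := by
  let ρ := Outcome.orbit W.base W.edge_base v
  have hρ : ∀ k, ρ.1 (k + 1) = W.base (ρ.1 k) := Outcome.orbit_succ W.base W.edge_base v
  have hb : W.FollowsBase ρ := fun k _ => hρ k
  have hm : Monotone fun k => W.a (ρ.1 k) := monotone_nat_of_le_succ hb.le_succ
  refine ⟨ρ, rfl, hb, ?_⟩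
  by_cases hex : ∃ k, W.a v < W.a (ρ.1 k)
  · obtain ⟨k, hk⟩ := hex
    exact hk.trans_le (hb.le_pay k)
  · push Not at hex
    have heq : ∀ k, W.a (ρ.1 k) = W.a v := fun k => le_antisymm (hex k) (hm (Nat.zero_le k))
    have hstep : ∀ k, W.Hopeful (ρ.1 k) → W.Hopeful (ρ.1 (k + 1)) ∧
        (0 ≤ W.a (ρ.1 k) → W.dist (ρ.1 (k + 1)) < W.dist (ρ.1 k)) := by
      intro k hk
      have h1 : ρ.1 (k + 1) = W.coop (ρ.1 k) := by
        rw [hρ k]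
        exact if_pos ⟨by rw [heq]; exact h0, hk⟩
      have h2 := (W.coop_spec hk).2
      rw [← h1, heq, heq] at h2
      rw [heq]
      exact h2 rfl
    have hhope : ∀ k, W.Hopeful (ρ.1 k) := by
      intro k
      induction k with
      | zero => exact h
      | succ k ih => exact (hstep k ih).1
    have hpay : W.pay ρ = 0 := leafPay_of_forall_notMem fun k => (hhope k).notMem
    rw [hpay]
    refine lt_of_le_of_ne h0 fun h00 => ?_
    exact not_strictAnti_of_wellFoundedLT (fun k => W.dist (ρ.1 k))
      (strictAnti_nat_of_succ_lt fun k => (hstep k (hhope k)).2 (by rw [heq, h00]))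

variable (W)

/-- The vertices where player `i` faces a dilemma: `base` guarantees the value but excludes any
surplus, whereas some hope path promises a surplus. -/
def Critical (v : V) : Prop := A.owner v = i ∧ W.Hopeful v ∧ ¬ W.Promising v

variable {W}

theorem Critical.pos {v : V} (h : W.Critical v) : 0 < W.a v := by
  by_contra! h0
  exact h.2.2 (h.2.1.promising h0)

/-! ### Improving a strategy with a bounded number of attempts -/

variable (W) (R : A.Machine)

/-- From the memory state and the vertex at hand, the machine `R` may get more than the value of the
vertex. -/
def Keeps (q : Option R.S) (v : V) : Prop :=
  ∃ m, q = some m ∧ ∃ ρ, ρ.1 0 = v ∧ R.Followed i m ρ ∧ W.a v < W.pay ρ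

open Classical in
/-- The machine which imitates `R` as long as `R` may get more than the value of the current vertex.
When this fails, its memory becomes `none` forever, and it plays `base`, except that it moves along a
hope path at a critical vertex. The counter bounds the number of these exceptions. -/
noncomputable def improve : A.Machine where
  S := Option R.S × ℕ
  upd s v := (if W.Keeps R s.1 v then s.1.map fun m => R.upd m v else none,
    if ¬ W.Keeps R s.1 v ∧ W.Critical v then s.2 - 1 else s.2)
  act s v := if W.Keeps R s.1 v then s.1.elim (W.α v) fun m => R.act m v else
    if W.Critical v ∧ 0 < s.2 then W.coop v else W.base v
  legal s v := by
    split_ifs with h h'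
    · obtain ⟨m, hm, -⟩ := h
      rw [hm]
      exact R.legal m v
    · exact W.edge_coop v
    · exact W.edge_base v

variable {W R}

theorem not_keeps_none (v : V) : ¬ W.Keeps R none v := by
  rintro ⟨m, hm, -⟩
  cases hm

theorem improve_upd_fst {s : Option R.S × ℕ} {v : V} (h : ¬ W.Keeps R s.1 v) :
    ((W.improve R).upd s v).1 = none :=
  if_neg h

open Classical in
theorem improve_act {s : Option R.S × ℕ} {v : V} (h : ¬ W.Keeps R s.1 v) :
    (W.improve R).act s v = if W.Critical v ∧ 0 < s.2 then W.coop v else W.base v :=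
  if_neg h

theorem improve_upd_snd_of_not_critical (s : Option R.S × ℕ) {v : V} (h : ¬ W.Critical v) :
    ((W.improve R).upd s v).2 = s.2 :=
  if_neg fun h' => h h'.2

theorem improve_upd_snd_of_keeps {s : Option R.S × ℕ} {v : V} (h : W.Keeps R s.1 v) :
    ((W.improve R).upd s v).2 = s.2 :=
  if_neg fun h' => h'.1 h

theorem improve_upd_snd_of_critical {s : Option R.S × ℕ} {v : V} (h : ¬ W.Keeps R s.1 v)
    (h' : W.Critical v) : ((W.improve R).upd s v).2 = s.2 - 1 :=
  if_pos ⟨h, h'⟩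

theorem improve_upd_snd_le (s : Option R.S × ℕ) (v : V) : ((W.improve R).upd s v).2 ≤ s.2 := by
  by_cases h : ¬ W.Keeps R s.1 v ∧ W.Critical v
  · rw [improve_upd_snd_of_critical h.1 h.2]; omega
  · exact (if_neg h).le

theorem le_improve_upd_snd (s : Option R.S × ℕ) (v : V) :
    s.2 - 1 ≤ ((W.improve R).upd s v).2 := by
  by_cases h : ¬ W.Keeps R s.1 v ∧ W.Critical v
  · rw [improve_upd_snd_of_critical h.1 h.2]
  · exact (Nat.sub_le _ _).trans (if_neg h).ge

/-- `R` has been abandoned when the machine `W.improve R`, started in `s`, reads vertex number `k`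
of `ρ`. -/
def Switched (W : ValuedArena A i) (R : A.Machine) (s : Option R.S × ℕ) (ρ : A.Outcome) (k : ℕ) :
    Prop :=
  ¬ W.Keeps R ((W.improve R).run s ρ.1 k).1 (ρ.1 k)

theorem Switched.succ {s : Option R.S × ℕ} {ρ : A.Outcome} {k : ℕ} (h : W.Switched R s ρ k) :
    W.Switched R s ρ (k + 1) := by
  have h1 : ((W.improve R).run s ρ.1 (k + 1)).1 = none := improve_upd_fst h
  unfold Switched
  rw [h1]
  exact not_keeps_none _

theorem Switched.mono {s : Option R.S × ℕ} {ρ : A.Outcome} {k l : ℕ} (h : W.Switched R s ρ k)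
    (hl : k ≤ l) : W.Switched R s ρ l := by
  induction l, hl using Nat.le_induction with
  | base => exact h
  | succ l _ ih => exact ih.succ

theorem Switched.congr {s : Option R.S × ℕ} {ρ ρ' : A.Outcome} {k : ℕ} (h : W.Switched R s ρ k)
    (e : ρ.Agree k ρ') : W.Switched R s ρ' k := by
  unfold Switched at *
  rwa [← (W.improve R).run_agree s e, ← e k le_rfl]

theorem le_improve_act {s : Option R.S × ℕ} {v : V} (h : ¬ W.Keeps R s.1 v) :
    W.a v ≤ W.a ((W.improve R).act s v) := by
  rw [improve_act h]
  split_ifs with h'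
  · exact (W.coop_spec h'.1.2.1).1
  · exact W.le_base v

theorem Switched.value_le {s : Option R.S × ℕ} {ρ : A.Outcome} {j k n : ℕ}
    (h : W.Switched R s ρ j) (hf : (W.improve R).FollowedUpto i s ρ n) (hjk : j ≤ k) (hkn : k ≤ n) :
    W.a (ρ.1 j) ≤ W.a (ρ.1 k) := by
  induction k, hjk using Nat.le_induction with
  | base => rfl
  | succ k hk ih =>
    refine (ih (by omega)).trans ?_
    by_cases hv : A.owner (ρ.1 k) = i
    · rw [hf k (by omega) hv]
      exact le_improve_act (h.mono hk)
    · exact W.isVal.opp_le _ _ hv (ρ.2 k)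

theorem Switched.tail {s : Option R.S × ℕ} {ρ : A.Outcome} {j : ℕ}
    (h : W.Switched R s ρ j) : W.Switched R ((W.improve R).run s ρ.1 j) (ρ.tail j) 0 :=
  h

/-- Once `R` is abandoned, the value of the current vertex is guaranteed: between two uses of
the counter, the ranking of the optimal positional strategy decreases. -/
theorem Switched.le_pay {s : Option R.S × ℕ} {ρ : A.Outcome} {j : ℕ}
    (h : W.Switched R s ρ j) (hf : (W.improve R).Followed i s ρ) : W.a (ρ.1 j) ≤ W.pay ρ := by
  rw [← W.pay_tail ρ j]
  replace hf := hf.tail j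
  replace h := h.tail
  change W.a ((ρ.tail j).1 0) ≤ _
  generalize ρ.tail j = π at *
  generalize (W.improve R).run s ρ.1 j = s' at *
  let N : ℕ → ℕ := fun k => ((W.improve R).run s' π.1 k).2
  refine le_leafPay (b := W.a) W.isVal.leaf W.isVal.eq_leaf π.2
    (fun k => (h.mono (Nat.zero_le k)).value_le (hf.upto (k + 1)) (Nat.le_succ k) le_rfl)
    (fun k => toLex (N k, W.μ (π.1 k))) fun k hpos hL => ?_
  · have hk : W.Switched R s' π k := h.mono (Nat.zero_le k)
    rw [Prod.Lex.toLex_lt_toLex]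
    change N (k + 1) < N k ∨ N (k + 1) = N k ∧ W.μ (π.1 (k + 1)) < W.μ (π.1 k)
    by_cases hc : W.Critical (π.1 k) ∧ 0 < N k
    · left
      have h1 : N (k + 1) = N k - 1 := improve_upd_snd_of_critical hk hc.1
      omega
    · right
      constructor
      · by_cases hc' : W.Critical (π.1 k)
        · have h1 : N (k + 1) = N k - 1 := improve_upd_snd_of_critical hk hc'
          have h2 : N k = 0 := by
            by_contra h3
            exact hc ⟨hc', Nat.pos_of_ne_zero h3⟩
          omega
        · exact improve_upd_snd_of_not_critical _ hc'
      · by_cases hv : A.owner (π.1 k) = i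
        · rw [hf k hv, improve_act hk, if_neg hc, W.base_of_pos hpos]
          exact W.isVal.own_lt _ hv hpos hL
        · exact W.isVal.opp_lt _ _ hv hpos hL (π.2 k)

/-- At a critical vertex, with an exhausted counter, there is no surplus to hope for. -/
theorem Switched.pay_le_of_critical {s : Option R.S × ℕ} {ρ : A.Outcome} {j : ℕ}
    (h : W.Switched R s ρ j) (hf : (W.improve R).Followed i s ρ)
    (h0 : ((W.improve R).run s ρ.1 j).2 = 0) (hc : W.Critical (ρ.1 j)) :
    W.pay ρ ≤ W.a (ρ.1 j) := by
  rw [← W.pay_tail ρ j]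
  by_contra! hcon
  refine hc.2.2 ⟨ρ.tail j, rfl, fun k hk => ?_, hcon⟩
  have hN : ∀ k, ((W.improve R).run s ρ.1 (j + k)).2 = 0 := by
    intro k
    induction k with
    | zero => exact h0
    | succ k ih =>
      have := improve_upd_snd_le (W := W) ((W.improve R).run s ρ.1 (j + k)) (ρ.1 (j + k))
      rw [ih] at this
      exact Nat.le_zero.1 this
  have h1 := hf (j + k) hk
  rw [improve_act (h.mono (Nat.le_add_right j k)), if_neg (by rw [hN]; simp)] at h1
  exact h1

/-- Where there is no hope for a surplus, the value is all that is obtained. -/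
theorem Switched.pay_eq_of_not_hopeful {s : Option R.S × ℕ} {ρ : A.Outcome} {j : ℕ}
    (h : W.Switched R s ρ j) (hf : (W.improve R).Followed i s ρ) (hh : ¬ W.Hopeful (ρ.1 j)) :
    W.pay ρ = W.a (ρ.1 j) := by
  refine le_antisymm ?_ (h.le_pay hf)
  by_contra! hcon
  refine hh ⟨ρ.tail j, rfl, fun k => ?_, by rwa [W.pay_tail]⟩
  exact h.value_le (hf.upto (j + k)) (Nat.le_add_right j k) le_rfl

theorem exists_followed_of_not_keeps {s : Option R.S × ℕ} {v : V} (h : ¬ W.Keeps R s.1 v) :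
    ∃ ρ : A.Outcome, ρ.1 0 = v ∧ (W.improve R).Followed i s ρ ∧ W.a v ≤ W.pay ρ := by
  obtain ⟨ρ, rfl, hρ⟩ := (W.improve R).exists_followed i s v
  exact ⟨ρ, rfl, hρ, Switched.le_pay (j := 0) h hρ⟩

theorem run_improve_of_keeps {m : R.S} {N : ℕ} {π : A.Outcome} {j : ℕ}
    (h : ∀ k < j, W.Keeps R (some (R.run m π.1 k)) (π.1 k)) :
    (W.improve R).run (some m, N) π.1 j = (some (R.run m π.1 j), N) := by
  induction j with
  | zero => rfl
  | succ j ih =>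
    have e := ih fun k hk => h k (by omega)
    have hk := h j (by omega)
    change (W.improve R).upd _ _ = _
    rw [e]
    refine Prod.ext ?_ (improve_upd_snd_of_keeps hk)
    exact if_pos hk

theorem followedUpto_improve_of_keeps {m : R.S} {N : ℕ} {π : A.Outcome} {j : ℕ}
    (hπ : R.FollowedUpto i m π j) (h : ∀ k < j, W.Keeps R (some (R.run m π.1 k)) (π.1 k)) :
    (W.improve R).FollowedUpto i (some m, N) π j := by
  intro k hk hv
  rw [run_improve_of_keeps fun l hl => h l (by omega), hπ k hk hv]
  exact (if_pos (h k hk)).symm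

/-- As long as `R` is imitated, a surplus may be obtained: along a path on which `R` gets a
surplus, `R` is abandoned only if the value rises above the payoff of this path. -/
theorem Keeps.exists_lt_pay {s : Option R.S × ℕ} {v : V} (h : W.Keeps R s.1 v) :
    ∃ ρ : A.Outcome, ρ.1 0 = v ∧ (W.improve R).Followed i s ρ ∧ W.a v < W.pay ρ := by
  classical
  obtain ⟨q, N⟩ := s
  obtain ⟨m, hm, π, rfl, hπ, hlt⟩ := h
  obtain rfl : q = some m := hm
  by_cases hall : ∀ k, W.Keeps R (some (R.run m π.1 k)) (π.1 k)
  · exact ⟨π, rfl, fun k => followedUpto_improve_of_keeps (hπ.upto (k + 1)) (fun l _ => hall l) k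
      (Nat.lt_succ_self k), hlt⟩
  · push Not at hall
    have hj := Nat.find_spec hall
    have hmin : ∀ k < Nat.find hall, W.Keeps R (some (R.run m π.1 k)) (π.1 k) :=
      fun k hk => not_not.1 (Nat.find_min hall hk)
    generalize Nat.find hall = j at hj hmin
    have hrun := run_improve_of_keeps (N := N) hmin
    obtain ⟨ρ, h0, hρ, hle⟩ := exists_followed_of_not_keeps (s := (some (R.run m π.1 j), N)) hj
    refine ⟨π.splice j ρ h0, ((π.agree_splice j ρ h0) 0 (Nat.zero_le j)).symm,
      (followedUpto_improve_of_keeps (hπ.upto j) hmin).splice (by rw [hrun]; exact hρ) h0, ?_⟩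
    rw [W.pay_splice]
    have h1 : W.pay π ≤ W.a (π.1 j) := by
      by_contra! hcon
      exact hj ⟨_, rfl, π.tail j, rfl, hπ.tail j, by rwa [W.pay_tail]⟩
    omega

/-- At a promising vertex, a surplus may be obtained by playing `base`; no critical vertex is met
before the value rises. -/
theorem Promising.exists_lt_pay {s : Option R.S × ℕ} {v : V} (hp : W.Promising v)
    (h : ¬ W.Keeps R s.1 v) :
    ∃ ρ : A.Outcome, ρ.1 0 = v ∧ (W.improve R).Followed i s ρ ∧ W.a v < W.pay ρ := by
  classical
  obtain ⟨π, rfl, hπ, hlt⟩ := hp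
  have hm : Monotone fun k => W.a (π.1 k) := monotone_nat_of_le_succ hπ.le_succ
  have hsw : ∀ k, W.Switched R s π k := fun k => Switched.mono (k := 0) h (Nat.zero_le k)
  have hact : ∀ k, W.a (π.1 k) = W.a (π.1 0) → A.owner (π.1 k) = i →
      π.1 (k + 1) = (W.improve R).act ((W.improve R).run s π.1 k) (π.1 k) := by
    intro k hk hv
    rw [improve_act (hsw k), if_neg, hπ k hv]
    intro hc
    exact hc.1.2.2 ⟨π.tail k, rfl, hπ.tail k, by rwa [W.pay_tail, hk]⟩
  by_cases hall : ∀ k, W.a (π.1 k) = W.a (π.1 0)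
  · exact ⟨π, rfl, fun k => hact k (hall k), hlt⟩
  · push Not at hall
    have hj := Nat.find_spec hall
    have hmin : ∀ k < Nat.find hall, W.a (π.1 k) = W.a (π.1 0) :=
      fun k hk => not_not.1 (Nat.find_min hall hk)
    generalize Nat.find hall = j at hj hmin
    obtain ⟨ρ, h0, hρ, hle⟩ := exists_followed_of_not_keeps (hsw j)
    refine ⟨π.splice j ρ h0, ((π.agree_splice j ρ h0) 0 (Nat.zero_le j)).symm,
      Machine.FollowedUpto.splice (fun k hk => hact k (hmin k hk)) hρ h0, ?_⟩
    rw [W.pay_splice]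
    exact (lt_of_le_of_ne (hm (Nat.zero_le j)) hj.symm).trans_le hle

/-- At a hopeful vertex, a surplus may be obtained if the counter is large enough for walking to
the end of a hope path. -/
theorem Hopeful.exists_lt_pay {s : Option R.S × ℕ} {v : V} (hh : W.Hopeful v)
    (h : ¬ W.Keeps R s.1 v) (hd : W.dist v ≤ s.2) :
    ∃ ρ : A.Outcome, ρ.1 0 = v ∧ (W.improve R).Followed i s ρ ∧ W.a v < W.pay ρ := by
  induction hk : W.dist v using Nat.strong_induction_on generalizing v s with
  | _ k ih =>
    by_cases hp : W.Promising v
    · exact hp.exists_lt_pay h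
    · have hpos : 0 < W.a v := by
        by_contra! h0
        exact hp (hh.promising h0)
      obtain ⟨hle, hnext⟩ := W.coop_spec hh
      have hk' : ¬ W.Keeps R ((W.improve R).upd s v).1 (W.coop v) := by
        rw [improve_upd_fst h]; exact not_keeps_none _
      have hrec : ∃ ρ : A.Outcome, ρ.1 0 = W.coop v ∧
          (W.improve R).Followed i ((W.improve R).upd s v) ρ ∧ W.a v < W.pay ρ := by
        rcases hle.lt_or_eq with hlt | heq
        · obtain ⟨ρ, h0, hρ, hle'⟩ := exists_followed_of_not_keeps hk'
          exact ⟨ρ, h0, hρ, hlt.trans_le hle'⟩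
        · obtain ⟨hh', hd'⟩ := hnext heq.symm
          have hlt := hd' hpos.le
          have hN : s.2 - 1 ≤ ((W.improve R).upd s v).2 := le_improve_upd_snd s v
          obtain ⟨ρ, h0, hρ, hp'⟩ := ih _ (by omega) hh' hk' (by omega) rfl
          exact ⟨ρ, h0, hρ, by rwa [heq]⟩
      obtain ⟨ρ, h0, hρ, hlt⟩ := hrec
      have he : A.Edge v (ρ.1 0) := by rw [h0]; exact W.edge_coop v
      refine ⟨ρ.cons v he, rfl, hρ.cons he fun hv => ?_, by rwa [W.pay_cons]⟩
      have hpos' : 0 < s.2 := by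
        -- a critical vertex has a successor on a hope path with the same value
        have heq : W.a (W.coop v) = W.a v :=
          le_antisymm (W.isVal.own_le _ _ hv (W.edge_coop v)) hle
        have := (hnext heq).2 hpos.le
        omega
      rw [h0, improve_act h, if_pos ⟨⟨hv, hh, hp⟩, hpos'⟩]

end ValuedArena

namespace ValuedArena

variable {P V : Type*} {A : Arena P V} {i : P} {W : ValuedArena A i} {R : A.Machine}

/-! ### Finite-memory and uniform realizations -/

open Classical in
theorem improve_act_congr (q : Option R.S) (v : V) {N N' : ℕ} (h : 0 < N ↔ 0 < N') :
    (W.improve R).act (q, N) v = (W.improve R).act (q, N') v := by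
  by_cases hk : W.Keeps R q v
  · exact (if_pos hk).trans (if_pos hk).symm
  · rw [improve_act (s := (q, N)) hk, improve_act (s := (q, N')) hk]
    simp only [h]

theorem finiteMemory_improve [Finite R.S] (q : Option R.S) (N : ℕ) :
    ((W.improve R).strategy i (q, N)).FiniteMemory := by
  let T := W.improve R
  let dec : Option R.S × Fin (N + 1) → T.S := fun x => (x.1, x.2.1)
  let 𝓜 : A.Mealy i :=
    { M := Option R.S × Fin (N + 1)
      finite := inferInstance
      init := (q, Fin.last N)
      update := fun x v => ((T.upd (dec x) v).1,
        ⟨(T.upd (dec x) v).2, (improve_upd_snd_le _ _).trans_lt x.2.2⟩)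
      choose := fun x v _ => T.act (dec x) v
      legal := fun x v _ => T.legal _ _ }
  refine ⟨𝓜, ?_⟩
  have h : ∀ l : List V, dec (l.foldl 𝓜.update 𝓜.init) = l.foldl T.upd (q, N) := fun l =>
    (List.foldl_hom dec (g₁ := 𝓜.update) (g₂ := T.upd) fun _ _ => rfl).symm
  ext x hx
  change T.act (dec (x.past.foldl 𝓜.update 𝓜.init)) x.last = T.act (x.past.foldl T.upd (q, N)) x.last
  rw [h]

open Classical in
/-- The machines `W.improve R`, started with the counter values `c * n`, are realized uniformly. The
automaton counts by packets of `c` units: the memory holds the current packet, of `f ≤ c` units, and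
the counter is accessed when this packet is used up. Hence the automaton can detect whether the
represented value `c * n + f` is zero, although it decrements its counter blindly. -/
theorem exists_paramAutomaton [Finite R.S] (q : Option R.S) {c : ℕ} (hc : 0 < c) :
    ∃ 𝓜 : A.ParamAutomaton i, ∀ n, 𝓜.strategy n = (W.improve R).strategy i (q, c * n) := by
  let T := W.improve R
  let D : Option R.S → V → Prop := fun q v => ¬ W.Keeps R q v ∧ W.Critical v
  let nextQ : Option R.S → V → Option R.S := fun q v => (T.upd (q, 0) v).1
  let dec : (Option R.S × Fin (c + 1)) × ℕ → T.S := fun x => (x.1.1, c * x.2 + x.1.2.1)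
  let upd : Option R.S × Fin (c + 1) → V → ℕ → (Option R.S × Fin (c + 1)) × ℕ := fun x v n =>
    if x.2.1 = 0 then
      if n = 0 then ((nextQ x.1 v, 0), 0)
      else ((nextQ x.1 v, ⟨if D x.1 v then c - 1 else c, by split_ifs <;> omega⟩), n - 1)
    else ((nextQ x.1 v, ⟨if D x.1 v then x.2.1 - 1 else x.2.1, by split_ifs <;> omega⟩), n)
  let 𝓜 : A.ParamAutomaton i :=
    { M := Option R.S × Fin (c + 1)
      finite := inferInstance
      access := {x | x.2.1 = 0}
      init := (q, 0)
      update := upd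
      choose := fun x v _ n => T.act (dec (x, n)) v
      legal := fun x v _ n => T.legal _ _
      update_black := fun x hx v => ⟨_, fun n => if_neg hx⟩
      update_green := fun x hx v => ⟨_, fun n hn => (if_pos hx).trans (if_neg hn.ne')⟩
      update_red := fun x hx v => ⟨_, (if_pos hx).trans (if_pos rfl)⟩
      choose_black := fun x hx v _ => ⟨T.act (x.1, 1) v, fun n => by
        refine improve_act_congr x.1 v ?_
        have : x.2.1 ≠ 0 := hx
        exact ⟨fun _ => one_pos, fun _ => by positivity⟩⟩
      choose_green := fun x hx v _ => ⟨T.act (x.1, 1) v, fun n hn => by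
        refine improve_act_congr x.1 v ?_
        exact ⟨fun _ => one_pos, fun _ => by positivity⟩⟩ }
  refine ⟨𝓜, fun n => ?_⟩
  have hupd : ∀ (x : (Option R.S × Fin (c + 1)) × ℕ) v, T.upd (dec x) v = dec (upd x.1 v x.2) := by
    rintro ⟨⟨p, f⟩, n⟩ v
    have h1 : T.upd (dec ((p, f), n)) v =
        (nextQ p v, if D p v then c * n + f.1 - 1 else c * n + f.1) := rfl
    rw [h1]
    by_cases hf : f.1 = 0
    · rcases n with _ | n
      · have h2 : upd (p, f) v 0 = ((nextQ p v, 0), 0) := (if_pos hf).trans (if_pos rfl)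
        rw [h2]
        refine Prod.ext rfl ?_
        change ite _ _ _ = c * 0 + 0
        rw [hf]
        simp
      · have h2 : upd (p, f) v (n + 1) =
            ((nextQ p v, ⟨if D p v then c - 1 else c, by split_ifs <;> omega⟩), n) :=
          (if_pos hf).trans (if_neg (Nat.succ_ne_zero n))
        rw [h2]
        refine Prod.ext rfl ?_
        change ite _ _ _ = c * n + ite _ _ _
        rw [hf, mul_add]
        split_ifs <;> omega
    · have h2 : upd (p, f) v n =
          ((nextQ p v, ⟨if D p v then f.1 - 1 else f.1, by split_ifs <;> omega⟩), n) :=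
        if_neg hf
      rw [h2]
      refine Prod.ext rfl ?_
      change ite _ _ _ = c * n + ite _ _ _
      split_ifs <;> omega
  have h : ∀ l : List V, dec (l.foldl (fun x v => upd x.1 v x.2) ((q, 0), n)) =
      l.foldl T.upd (q, c * n) := fun l =>
    (List.foldl_hom dec (g₁ := fun x v => upd x.1 v x.2) (g₂ := T.upd) hupd).symm
  ext x hx
  change T.act (dec (x.past.foldl (fun x v => upd x.1 v x.2) ((q, 0), n))) x.last =
    T.act (x.past.foldl T.upd (q, c * n)) x.last
  rw [h]

/-! ### Continuations of a history -/

/-- No strategy guarantees more than the value of the last vertex of a history. -/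
theorem exists_pay_le {s : A.Strategy i} {ρ : A.Outcome} {k : ℕ} (h : s.FollowedUpto ρ k) :
    ∃ ρ' : A.Outcome, ρ.Agree k ρ' ∧ s.Followed ρ' ∧ W.pay ρ' ≤ W.a (ρ.1 k) := by
  obtain ⟨ρ', e, hs, hω⟩ := h.exists_extend W.ω W.isVal.edge_opp
  exact ⟨ρ', e, hs, by rw [e k le_rfl]; exact W.isVal.leafPay_le ρ'.1 k ρ'.2 hω⟩

theorem exists_deviation (W : ValuedArena A i) {s : A.Strategy i} {ρ : A.Outcome}
    (h : ¬ s.Followed ρ) :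
    ∃ (k : ℕ) (ρ' : A.Outcome), A.owner (ρ.1 k) = i ∧ s.FollowedUpto ρ k ∧ ρ.Agree k ρ' ∧
      s.Followed ρ' ∧ ρ.1 (k + 1) ≠ ρ'.1 (k + 1) ∧ W.pay ρ' ≤ W.a (ρ.1 k) := by
  obtain ⟨k, hk, h1, h2⟩ := Strategy.exists_first_deviation h
  obtain ⟨ρ', e, hs, hp⟩ := W.exists_pay_le h1
  refine ⟨k, ρ', hk, h1, e, hs, fun h3 => h2 ?_, hp⟩
  rw [h3, hs k (by rw [← e k le_rfl]; exact hk)]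
  exact s.move_congr (Outcome.hist_eq e.symm) _ _

theorem exists_lt_pay_of_keeps {s : Option R.S × ℕ} {ρ : A.Outcome} {k : ℕ}
    (hf : (W.improve R).FollowedUpto i s ρ k) (h : ¬ W.Switched R s ρ k) :
    ∃ ρ' : A.Outcome, ρ.Agree k ρ' ∧ (W.improve R).Followed i s ρ' ∧ W.a (ρ.1 k) < W.pay ρ' := by
  obtain ⟨π, h0, hπ, hlt⟩ := (not_not.1 h).exists_lt_pay
  exact ⟨ρ.splice k π h0, ρ.agree_splice k π h0, hf.splice hπ h0, by rwa [W.pay_splice]⟩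

theorem Switched.exists_lt_pay {s : Option R.S × ℕ} {ρ : A.Outcome} {k : ℕ}
    (h : W.Switched R s ρ k) (hf : (W.improve R).FollowedUpto i s ρ k) (hh : W.Hopeful (ρ.1 k))
    (hd : W.dist (ρ.1 k) ≤ ((W.improve R).run s ρ.1 k).2) :
    ∃ ρ' : A.Outcome, ρ.Agree k ρ' ∧ (W.improve R).Followed i s ρ' ∧ W.a (ρ.1 k) < W.pay ρ' := by
  obtain ⟨π, h0, hπ, hlt⟩ := hh.exists_lt_pay h hd
  exact ⟨ρ.splice k π h0, ρ.agree_splice k π h0, hf.splice hπ h0, by rwa [W.pay_splice]⟩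

theorem run_improve_le (q : Option R.S) {N N' : ℕ} (hN : N ≤ N') (ρ : A.Outcome) (k : ℕ) :
    ((W.improve R).run (q, N) ρ.1 k).1 = ((W.improve R).run (q, N') ρ.1 k).1 ∧
      ((W.improve R).run (q, N) ρ.1 k).2 ≤ ((W.improve R).run (q, N') ρ.1 k).2 := by
  induction k with
  | zero => exact ⟨rfl, hN⟩
  | succ k ih =>
    change ((W.improve R).upd _ _).1 = ((W.improve R).upd _ _).1 ∧
      ((W.improve R).upd _ _).2 ≤ ((W.improve R).upd _ _).2
    generalize (W.improve R).run (q, N) ρ.1 k = s at ih ⊢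
    generalize (W.improve R).run (q, N') ρ.1 k = s' at ih ⊢
    obtain ⟨p, m⟩ := s
    obtain ⟨p', m'⟩ := s'
    obtain ⟨rfl, hm⟩ : p = p' ∧ m ≤ m' := ih
    refine ⟨rfl, ?_⟩
    by_cases h : ¬ W.Keeps R p (ρ.1 k) ∧ W.Critical (ρ.1 k)
    · rw [improve_upd_snd_of_critical (s := (p, m)) h.1 h.2,
        improve_upd_snd_of_critical (s := (p, m')) h.1 h.2]
      exact Nat.sub_le_sub_right hm 1
    · exact (if_neg h).le.trans (hm.trans (if_neg h).ge)

open Classical in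
/-- Each decrement of the counter takes place at a critical vertex. -/
theorem counter_le (s : Option R.S × ℕ) (ρ : A.Outcome) (k : ℕ) :
    s.2 ≤ ((W.improve R).run s ρ.1 k).2 +
      ((Finset.range k).filter fun j => W.Switched R s ρ j ∧ W.Critical (ρ.1 j)).card := by
  induction k with
  | zero => simp [Machine.run]
  | succ k ih =>
    rw [Finset.range_add_one, Finset.filter_insert]
    change _ ≤ ((W.improve R).upd _ _).2 + _
    have h1 := le_improve_upd_snd (W := W) ((W.improve R).run s ρ.1 k) (ρ.1 k)
    split_ifs with h
    · rw [Finset.card_insert_of_notMem (by simp)]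
      omega
    · have h2 : ((W.improve R).upd ((W.improve R).run s ρ.1 k) (ρ.1 k)).2 =
          ((W.improve R).run s ρ.1 k).2 := if_neg h
      omega

end ValuedArena

/-! ### Repeating a segment of an outcome -/

namespace Arena

variable {P V : Type*} {A : Arena P V}

/-- Repeating forever the segment between two visits `j₁ < j₂` to the same vertex. -/
theorem Outcome.exists_pump (ρ : A.Outcome) {j₁ j₂ : ℕ} (hlt : j₁ < j₂) (e : ρ.1 j₁ = ρ.1 j₂) :
    ∃ (π : A.Outcome) (f : ℕ → ℕ), (∀ k, π.1 k = ρ.1 (f k)) ∧ (∀ k, π.1 (k + 1) = ρ.1 (f k + 1)) ∧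
      (∀ k, f k < j₂) ∧ (∀ k ≥ j₁, j₁ ≤ f k) ∧ ρ.Agree j₂ π ∧
      f 0 = 0 ∧ ∀ k, f (k + 1) = f k + 1 ∨ (f k + 1 = j₂ ∧ f (k + 1) = j₁) := by
  let f : ℕ → ℕ := fun k => Nat.rec 0 (fun _ m => if m + 1 = j₂ then j₁ else m + 1) k
  have hs : ∀ k, f (k + 1) = if f k + 1 = j₂ then j₁ else f k + 1 := fun _ => rfl
  have hs' : ∀ k, f (k + 1) = f k + 1 ∨ (f k + 1 = j₂ ∧ f (k + 1) = j₁) := by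
    intro k
    rw [hs]
    split_ifs with h
    · exact Or.inr ⟨h, rfl⟩
    · exact Or.inl rfl
  have hnext : ∀ k, ρ.1 (f (k + 1)) = ρ.1 (f k + 1) := by
    intro k
    rcases hs' k with h | ⟨h, h'⟩
    · rw [h]
    · rw [h, h', e]
  have h0 : f 0 = 0 := rfl
  have hid : ∀ k < j₂, f k = k := by
    intro k
    induction k with
    | zero => exact fun _ => rfl
    | succ k ih =>
      intro hk
      rw [hs, ih (by omega), if_neg (by omega)]
  have hbd : ∀ k, f k < j₂ := by
    intro k
    induction k with
    | zero => omega
    | succ k ih => rw [hs]; split_ifs <;> omega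
  have hge : ∀ k ≥ j₁, j₁ ≤ f k := by
    intro k hk
    induction k, hk using Nat.le_induction with
    | base => rw [hid j₁ hlt]
    | succ k _ ih => rw [hs]; split_ifs <;> omega
  refine ⟨⟨fun k => ρ.1 (f k), fun k => ?_⟩, f, fun _ => rfl, hnext, hbd, hge, ?_, h0, hs'⟩
  · beta_reduce
    rw [hnext]
    exact ρ.2 (f k)
  · intro j hj
    change ρ.1 j = ρ.1 (f j)
    rcases hj.lt_or_eq with hj | rfl
    · rw [hid j hj]
    · obtain ⟨m, rfl⟩ : ∃ m, j = m + 1 := ⟨j - 1, by omega⟩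
      rw [hnext, hid m (by omega)]

end Arena

namespace Game

variable {P V : Type*} {G : Game P V} {i : P} {v₀ : V} {W : ValuedArena G.toArena i}
  {R : G.toArena.Machine}

/-- The payoffs of player `i` in `G` are those described by `W`. -/
def PaysAs (G : Game P V) (W : ValuedArena G.toArena i) : Prop :=
  ∀ ρ : G.Outcome, G.payoff i ρ = W.pay ρ

open Classical in
theorem IsGenSafetyReach.exists_paysAs [Finite V] (hG : G.IsGenSafetyReach i) :
    ∃ W : ValuedArena G.toArena i, G.PaysAs W := by
  obtain ⟨L, n, hL, h1, h2⟩ := hG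
  let n' : V → ℤ := fun v => if h : v ∈ L then n ⟨v, h⟩ else 0
  obtain ⟨a, μ, α, ω, h⟩ := exists_isValuation (own := fun v => G.owner v = i) (L := L) (n := n')
    G.exists_succ hL (fun v hv => dif_neg hv)
  refine ⟨⟨L, n', a, μ, α, ω, h⟩, fun ρ => ?_⟩
  by_cases hρ : ∃ k, ρ.1 k ∈ L
  · obtain ⟨k, hk⟩ := hρ
    have h3 : leafPay L n' ρ.1 = n' (ρ.1 k) := leafPay_of_mem hL ρ.2 hk
    rw [h1 ρ ⟨ρ.1 k, hk⟩ ⟨k, fun m hm => eq_of_mem_leaf hL ρ.2 hk hm⟩]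
    change _ = ((leafPay L n' ρ.1 : ℤ) : ℝ)
    rw [h3]
    simp only [n', dif_pos hk]
  · push Not at hρ
    rw [h2 ρ fun ⟨l, N, hN⟩ => hρ N (by rw [hN N le_rfl]; exact l.2)]
    change _ = ((leafPay L n' ρ.1 : ℤ) : ℝ)
    rw [leafPay_of_forall_notMem hρ, Int.cast_zero]

/-! ### The improved strategies form a chain above the given strategy -/

theorem WeakDom.pay_le (hW : G.PaysAs W) {s s' : G.Strategy i} (h : G.WeakDom v₀ s s')
    {ρ ρ' : G.Outcome} (h0 : ρ.1 0 = v₀) {k : ℕ} (hs : s.Followed ρ) (hs' : s'.Followed ρ')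
    (e : ρ.Agree k ρ') (hk : G.owner (ρ.1 k) = i) (hne : ρ.1 (k + 1) ≠ ρ'.1 (k + 1)) :
    W.pay ρ ≤ W.pay ρ' := by
  have h1 := h.payoff_le h0 hs hs' e hk hne
  rw [hW, hW] at h1
  exact_mod_cast h1

theorem weakDom_of_pay (hW : G.PaysAs W) {s s' : G.Strategy i}
    (h : ∀ (ρ ρ' : G.Outcome) (k : ℕ), ρ.1 0 = v₀ → s.Followed ρ → s'.Followed ρ' →
      ρ.Agree k ρ' → G.owner (ρ.1 k) = i → ρ.1 (k + 1) ≠ ρ'.1 (k + 1) →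
      W.pay ρ ≤ W.pay ρ') : G.WeakDom v₀ s s' :=
  weakDom_of fun ρ ρ' k h0 hs hs' e hk hne => by
    rw [hW, hW]
    exact_mod_cast h ρ ρ' k h0 hs hs' e hk hne

theorem weakDom_improve (hW : G.PaysAs W) (m : R.S) (N : ℕ) :
    G.WeakDom v₀ (R.strategy i m) ((W.improve R).strategy i (some m, N)) := by
  classical
  refine weakDom_of_pay hW fun ρ ρ' k h0 hs hs' e hk hne => ?_
  replace hs := R.followed_strategy.1 hs
  replace hs' := (W.improve R).followed_strategy.1 hs'
  have hex : ∃ j, ¬ W.Keeps R (some (R.run m ρ.1 j)) (ρ.1 j) ∧ j ≤ k := by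
    by_contra! hcon
    have hkeep : ∀ j ≤ k, W.Keeps R (some (R.run m ρ.1 j)) (ρ.1 j) := fun j hj => by
      by_contra h1
      exact absurd hj (hcon j h1).not_ge
    refine hne ?_
    rw [hs k hk, hs' k (by rw [← e k le_rfl]; exact hk), ← e k le_rfl,
      ← (W.improve R).run_agree (some m, N) e, ValuedArena.run_improve_of_keeps fun j hj => hkeep j hj.le]
    exact (if_pos (hkeep k le_rfl)).symm
  obtain ⟨hj, hjk⟩ := Nat.find_spec hex
  have hmin : ∀ l < Nat.find hex, W.Keeps R (some (R.run m ρ.1 l)) (ρ.1 l) := fun l hl => by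
    by_contra h1
    exact Nat.find_min hex hl ⟨h1, by omega⟩
  generalize Nat.find hex = j at hj hjk hmin
  have hsw : W.Switched R (some m, N) ρ j := by
    unfold ValuedArena.Switched
    rw [ValuedArena.run_improve_of_keeps hmin]
    exact hj
  have h1 : W.pay ρ ≤ W.a (ρ.1 j) := by
    by_contra! hcon
    exact hj ⟨_, rfl, ρ.tail j, rfl, hs.tail j, by rwa [W.pay_tail]⟩
  have h2 := (hsw.congr (e.mono hjk)).le_pay hs'
  rw [← e j hjk] at h2
  exact h1.trans h2

theorem weakDom_improve_of_le (hW : G.PaysAs W) (q : Option R.S) {N N' : ℕ} (hN : N ≤ N') :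
    G.WeakDom v₀ ((W.improve R).strategy i (q, N)) ((W.improve R).strategy i (q, N')) := by
  classical
  refine weakDom_of_pay hW fun ρ ρ' k h0 hs hs' e hk hne => ?_
  replace hs := (W.improve R).followed_strategy.1 hs
  replace hs' := (W.improve R).followed_strategy.1 hs'
  obtain ⟨h1, h2⟩ := ValuedArena.run_improve_le (W := W) (R := R) q hN ρ k
  have e' := (W.improve R).run_agree (q, N') e
  rw [hs k hk, hs' k (by rw [← e k le_rfl]; exact hk), ← e', ← e k le_rfl] at hne
  have hsw : W.Switched R (q, N) ρ k := by
    intro hkeep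
    refine hne ((if_pos hkeep).trans ?_)
    rw [h1] at hkeep ⊢
    exact (if_pos hkeep).symm
  have hsw' : W.Switched R (q, N') ρ k := by
    unfold ValuedArena.Switched at *
    rwa [← h1]
  have hc : W.Critical (ρ.1 k) ∧ ((W.improve R).run (q, N) ρ.1 k).2 = 0 := by
    by_contra hcon
    refine hne ?_
    rw [ValuedArena.improve_act hsw, ValuedArena.improve_act hsw']
    by_cases hc : W.Critical (ρ.1 k)
    · have h3 : 0 < ((W.improve R).run (q, N) ρ.1 k).2 :=
        Nat.pos_of_ne_zero fun h => hcon ⟨hc, h⟩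
      rw [if_pos ⟨hc, h3⟩, if_pos ⟨hc, h3.trans_le h2⟩]
    · rw [if_neg fun h => hc h.1, if_neg fun h => hc h.1]
  have h3 := hsw.pay_le_of_critical hs hc.2 hc.1
  have h4 := (hsw'.congr e).le_pay hs'
  rw [← e k le_rfl] at h4
  exact h3.trans h4

/-- A strategy `s'` which weakly dominates an improved strategy leaves it only where the counter is too
low for pursuing a surplus, or else where no surplus can be hoped for; in the latter case,
nothing is gained. -/
theorem WeakDom.of_deviation (hW : G.PaysAs W) {s : Option R.S × ℕ} {s' : G.Strategy i}
    (h : G.WeakDom v₀ ((W.improve R).strategy i s) s') {ρ ρ' : G.Outcome} (h0 : ρ.1 0 = v₀) {k : ℕ}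
    (hs : (W.improve R).Followed i s ρ) (hs' : s'.Followed ρ') (e : ρ.Agree k ρ')
    (hk : G.owner (ρ.1 k) = i) (hne : ρ.1 (k + 1) ≠ ρ'.1 (k + 1)) :
    W.Switched R s ρ k ∧
      (W.Hopeful (ρ.1 k) → ((W.improve R).run s ρ.1 k).2 < W.dist (ρ.1 k)) ∧
      (¬ W.Hopeful (ρ.1 k) → W.pay ρ' = W.a (ρ.1 k)) := by
  have hk' : G.owner (ρ'.1 k) = i := by rw [← e k le_rfl]; exact hk
  have hS := (W.improve R).followed_strategy.2 hs
  have hno : ∀ ρ₁ : G.Outcome, ρ.Agree k ρ₁ → (W.improve R).Followed i s ρ₁ →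
      W.pay ρ₁ ≤ W.a (ρ.1 k) := by
    intro ρ₁ e₁ hs₁
    obtain ⟨ρ₂, e₂, hs₂, hp⟩ := W.exists_pay_le (hs'.upto k)
    rw [← e k le_rfl] at hp
    refine le_trans (h.pay_le hW ?_ ((W.improve R).followed_strategy.2 hs₁) hs₂
      (e₁.symm.trans (e.trans e₂)) ?_ ?_) hp
    · rw [← e₁ 0 (Nat.zero_le k), h0]
    · rw [← e₁ k le_rfl]; exact hk
    · rw [← hS.next_eq ((W.improve R).followed_strategy.2 hs₁) e₁ hk,
        ← hs'.next_eq hs₂ e₂ hk']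
      exact hne
  have hsw : W.Switched R s ρ k := by
    by_contra hsw
    obtain ⟨ρ₁, e₁, hs₁, hlt⟩ := ValuedArena.exists_lt_pay_of_keeps (hs.upto k) hsw
    exact hlt.not_ge (hno ρ₁ e₁ hs₁)
  refine ⟨hsw, fun hh => ?_, fun hh => ?_⟩
  · by_contra! hd
    obtain ⟨ρ₁, e₁, hs₁, hlt⟩ := hsw.exists_lt_pay (hs.upto k) hh hd
    exact hlt.not_ge (hno ρ₁ e₁ hs₁)
  · have hp := hsw.pay_eq_of_not_hopeful hs hh
    have hle : ∀ ρ₂ : G.Outcome, ρ'.Agree k ρ₂ → s'.Followed ρ₂ → W.a (ρ.1 k) ≤ W.pay ρ₂ := by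
      intro ρ₂ e₂ hs₂
      rw [← hp]
      refine h.pay_le hW h0 hS hs₂ (e.trans e₂) hk ?_
      rw [← hs'.next_eq hs₂ e₂ hk']
      exact hne
    refine le_antisymm ?_ (hle ρ' (fun _ _ => rfl) hs')
    by_contra! hcon
    refine hh ⟨ρ'.tail k, (e k le_rfl).symm, fun j => ?_, by rwa [W.pay_tail]⟩
    obtain ⟨ρ₂, e₂, hs₂, hp₂⟩ := W.exists_pay_le (hs'.upto (k + j))
    exact (hle ρ₂ (e₂.mono (Nat.le_add_right k j)) hs₂).trans hp₂

/-- An improved strategy which never runs out of its counter is admissible. -/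
theorem admissible_improve (hW : G.PaysAs W) {s : Option R.S × ℕ} {c : ℕ}
    (hc : ∀ v, W.dist v ≤ c)
    (hs : ∀ ρ : G.Outcome, ρ.1 0 = v₀ → (W.improve R).Followed i s ρ →
      ∀ k, c ≤ ((W.improve R).run s ρ.1 k).2) :
    G.Admissible v₀ ((W.improve R).strategy i s) := by
  rintro s' ⟨hwd, τ, hlt⟩
  rw [Game.pay, Game.pay, hW, hW] at hlt
  have hlt' : W.pay ((τ.join ((W.improve R).strategy i s)).outcome v₀) <
    W.pay ((τ.join s').outcome v₀) := by exact_mod_cast hlt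
  obtain ⟨k, e, hk, hne⟩ := exists_divergence ((W.improve R).strategy i s) s' τ
    (fun h => by rw [h] at hlt'; exact lt_irrefl _ hlt')
  have hf := (W.improve R).followed_strategy.1
    (τ.followed_outcome ((W.improve R).strategy i s) v₀)
  obtain ⟨hsw, h1, h2⟩ := hwd.of_deviation hW rfl hf (τ.followed_outcome s' v₀) e hk hne
  by_cases hh : W.Hopeful (((τ.join ((W.improve R).strategy i s)).outcome v₀).1 k)
  · have h3 := h1 hh
    have h4 := hc (((τ.join ((W.improve R).strategy i s)).outcome v₀).1 k)
    have h5 := hs _ rfl hf k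
    omega
  · rw [h2 hh, hsw.pay_eq_of_not_hopeful hf hh] at hlt'
    exact lt_irrefl _ hlt'

/-- If the counter started at `N + c` may fall below `c`, the strategy obtained from the initial
value `N` is not as good. -/
theorem exists_pay_lt_improve (hW : G.PaysAs W) {q : Option R.S} {c N : ℕ}
    (hc : ∀ v, W.dist v ≤ c) {ρ : G.Outcome} (h0 : ρ.1 0 = v₀)
    (hρ : (W.improve R).Followed i (q, N + c) ρ)
    (hlow : ∃ k, ((W.improve R).run (q, N + c) ρ.1 k).2 < c) :
    ∃ τ : G.CoProfile i, G.pay v₀ ((W.improve R).strategy i (q, N)) τ <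
      G.pay v₀ ((W.improve R).strategy i (q, N + c)) τ := by
  classical
  have hk := Nat.find_spec hlow
  have hmin : ∀ j < Nat.find hlow, c ≤ ((W.improve R).run (q, N + c) ρ.1 j).2 :=
    fun j hj => not_lt.1 (Nat.find_min hlow hj)
  generalize Nat.find hlow = k' at hk hmin
  have hc0 : 0 < c := (Nat.zero_le _).trans_lt hk
  obtain ⟨k, rfl⟩ : ∃ k, k' = k + 1 := by
    rcases k' with _ | k
    · exact absurd hk (by change ¬ N + c < c; omega)
    · exact ⟨k, rfl⟩
  -- the counters differ by `c` as long as the larger one does not fall below `c`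
  have hdiff : ∀ j ≤ k, ((W.improve R).run (q, N + c) ρ.1 j) =
      (((W.improve R).run (q, N) ρ.1 j).1, ((W.improve R).run (q, N) ρ.1 j).2 + c) := by
    intro j
    induction j with
    | zero => exact fun _ => rfl
    | succ j ih =>
      intro hj
      have h1 := hmin (j + 1) (by omega)
      change c ≤ ((W.improve R).upd _ _).2 at h1
      change (W.improve R).upd _ _ = (((W.improve R).upd _ _).1, ((W.improve R).upd _ _).2 + c)
      rw [ih (by omega)] at h1 ⊢
      generalize (W.improve R).run (q, N) ρ.1 j = s at h1 ⊢
      refine Prod.ext rfl ?_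
      by_cases h : ¬ W.Keeps R s.1 (ρ.1 j) ∧ W.Critical (ρ.1 j)
      · rw [ValuedArena.improve_upd_snd_of_critical (s := (s.1, s.2 + c)) h.1 h.2] at h1 ⊢
        rw [ValuedArena.improve_upd_snd_of_critical h.1 h.2]
        have h2 : c ≤ s.2 + c - 1 := h1
        change s.2 + c - 1 = s.2 - 1 + c
        omega
      · refine (if_neg h).trans ?_
        change s.2 + c = _ + c
        congr 1
        exact (if_neg h).symm
  have hdec : W.Switched R (q, N + c) ρ k ∧ W.Critical (ρ.1 k) ∧
      ((W.improve R).run (q, N) ρ.1 k).2 = 0 := by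
    have h1 := hmin k (Nat.lt_succ_self k)
    change ((W.improve R).upd _ _).2 < c at hk
    by_cases h : ¬ W.Keeps R ((W.improve R).run (q, N + c) ρ.1 k).1 (ρ.1 k) ∧ W.Critical (ρ.1 k)
    · refine ⟨h.1, h.2, ?_⟩
      rw [ValuedArena.improve_upd_snd_of_critical h.1 h.2, hdiff k le_rfl] at hk
      change ((W.improve R).run (q, N) ρ.1 k).2 + c - 1 < c at hk
      omega
    · exact absurd h1 (((if_neg h).ge.trans_lt hk).not_ge)
  obtain ⟨hsw, hcrit, hzero⟩ := hdec
  have hfu : (W.improve R).FollowedUpto i (q, N) ρ k := by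
    intro j hj hv
    rw [hρ j hv]
    have h1 := hmin (j + 1) (by omega)
    change c ≤ ((W.improve R).upd _ _).2 at h1
    rw [hdiff j hj.le] at h1 ⊢
    generalize (W.improve R).run (q, N) ρ.1 j = s at h1 ⊢
    by_cases hkeep : W.Keeps R s.1 (ρ.1 j)
    · exact (if_pos hkeep).trans (if_pos hkeep).symm
    · rw [ValuedArena.improve_act (s := (s.1, s.2 + c)) hkeep, ValuedArena.improve_act hkeep]
      by_cases hcr : W.Critical (ρ.1 j)
      · rw [ValuedArena.improve_upd_snd_of_critical (s := (s.1, s.2 + c)) hkeep hcr] at h1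
        have h2 : c ≤ s.2 + c - 1 := h1
        rw [if_pos ⟨hcr, by change 0 < s.2 + c; omega⟩, if_pos ⟨hcr, by omega⟩]
      · rw [if_neg fun h => hcr h.1, if_neg fun h => hcr h.1]
  obtain ⟨ρ', e, hρ', hlt⟩ := hsw.exists_lt_pay (hρ.upto k) hcrit.2.1 (by
    rw [hdiff k le_rfl]
    exact (hc _).trans (Nat.le_add_left _ _))
  obtain ⟨τ, hτ⟩ := exists_coProfile _ ρ' ((W.improve R).followed_strategy.2 hρ')
  rw [← e 0 (Nat.zero_le k), h0] at hτ
  refine ⟨τ, ?_⟩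
  have hag := τ.agree_outcome ((W.improve R).strategy i (q, N))
    ((W.improve R).strategy i (q, N + c)) v₀ k (by
      rw [hτ]
      exact (W.improve R).followedUpto_strategy.2 (hfu.congr e))
  rw [hτ] at hag
  have hag' := e.trans hag.symm
  have hf := (W.improve R).followed_strategy.1
    (τ.followed_outcome ((W.improve R).strategy i (q, N)) v₀)
  have hsw' : W.Switched R (q, N) ρ k := by
    unfold ValuedArena.Switched at *
    rwa [hdiff k le_rfl] at hsw
  have hle := (hsw'.congr hag').pay_le_of_critical hf
    (by rw [← (W.improve R).run_agree (q, N) hag']; exact hzero) (by rw [← hag' k le_rfl]; exact hcrit)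
  rw [← hag' k le_rfl] at hle
  rw [Game.pay, Game.pay, hW, hW, hτ]
  exact_mod_cast hle.trans_lt hlt

end Game

namespace Game

variable {P V : Type*} {G : Game P V} {i : P} {v₀ : V} {W : ValuedArena G.toArena i}
  {R : G.toArena.Machine}

/-! ### Maximality of the chain -/

/-- If the counter has been decremented often enough, then at two of these times the finite-memory
machine `Y` was in the same state at the same vertex. -/
theorem exists_repetition [Finite V] {Y : G.toArena.Machine} [Finite Y.S] {y : Y.S}
    {s : Option R.S × ℕ} {ρ : G.Outcome} {k : ℕ}
    (h : ((W.improve R).run s ρ.1 k).2 + Nat.card (Y.S × V) < s.2) :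
    ∃ j₁ j₂, j₁ < j₂ ∧ j₂ < k ∧ W.Switched R s ρ j₁ ∧ W.Critical (ρ.1 j₁) ∧ W.Critical (ρ.1 j₂) ∧
      Y.run y ρ.1 j₁ = Y.run y ρ.1 j₂ ∧ ρ.1 j₁ = ρ.1 j₂ := by
  classical
  have : Fintype (Y.S × V) := Fintype.ofFinite _
  have h1 := W.counter_le s ρ k
  obtain ⟨x, hx, x', hx', hne, e⟩ := Finset.exists_ne_map_eq_of_card_lt_of_maps_to
    (s := (Finset.range k).filter fun j => W.Switched R s ρ j ∧ W.Critical (ρ.1 j))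
    (t := (Finset.univ : Finset (Y.S × V))) (f := fun j => (Y.run y ρ.1 j, ρ.1 j))
    (by rw [Finset.card_univ, ← Nat.card_eq_fintype_card]; omega) (fun _ _ => by simp)
  simp only [Finset.mem_filter, Finset.mem_range] at hx hx'
  obtain ⟨e1, e2⟩ := Prod.mk.inj e
  rcases hne.lt_or_gt with hlt | hlt
  · exact ⟨x, x', hlt, hx'.1, hx.2.1, hx.2.2, hx'.2.2, e1, e2⟩
  · exact ⟨x', x, hlt, hx.1, hx'.2.1, hx'.2.2, hx.2.2, e1.symm, e2.symm⟩

/-- Suppose that `z` weakly dominates an improved strategy and the finite-memory strategy of `Y`.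
When `Y` has followed the improved strategy for a long time, it cannot hope for a surplus any more.
Indeed, the opponents can make `Y` repeat forever a segment that avoids the leaves, where the value
is positive. As `z` has to guarantee this value after the counter is exhausted, `z` leaves the
resulting outcome somewhere. From there on `Y` gets no more than what `z` guarantees, hence no
more than the value, and it behaves as at some earlier time on the actual outcome. -/
theorem pay_le_of_long_imitation [Finite V] (hW : G.PaysAs W) {Y : G.toArena.Machine} [Finite Y.S]
    {y : Y.S} {s : Option R.S × ℕ} {z : G.Strategy i}
    (hz : G.WeakDom v₀ ((W.improve R).strategy i s) z) (hyz : G.WeakDom v₀ (Y.strategy i y) z)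
    {ρ ρ' : G.Outcome} {k : ℕ} (h0 : ρ.1 0 = v₀) (hρ : (W.improve R).Followed i s ρ)
    (hρ' : Y.Followed i y ρ') (e : ρ.Agree k ρ') (hzρ : z.FollowedUpto ρ k)
    (hlow : ((W.improve R).run s ρ.1 k).2 + Nat.card (Y.S × V) < s.2) :
    W.pay ρ' ≤ W.a (ρ.1 k) := by
  obtain ⟨j₁, j₂, hlt, hj₂, hsw, hc₁, hc₂, eY, eV⟩ := exists_repetition (Y := Y) (y := y) hlow
  obtain ⟨π, f, hπ, hπs, hfb, hfg, hag, hf0, hfs⟩ := ρ.exists_pump hlt eV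
  have hπ0 : π.1 0 = v₀ := by rw [← hag 0 (Nat.zero_le _), h0]
  -- the machine `Y` is fooled by the repetition
  have hrun : ∀ j, Y.run y π.1 j = Y.run y ρ.1 (f j) := by
    intro j
    induction j with
    | zero => rw [hf0]; rfl
    | succ j ih =>
      have h1 : Y.run y π.1 (j + 1) = Y.run y ρ.1 (f j + 1) := by
        change Y.upd _ _ = Y.upd _ _
        rw [ih, hπ]
      rcases hfs j with h | ⟨h, h'⟩
      · rw [h1, h]
      · rw [h1, h, h', eY]
  have hYρ : Y.FollowedUpto i y ρ k := (hρ'.upto k).congr e.symm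
  have hYπ : Y.Followed i y π := by
    intro j hj
    rw [hπs, hrun, hπ]
    rw [hπ] at hj
    exact hYρ (f j) ((hfb j).trans hj₂) hj
  have hval : ∀ j ≥ j₁, W.a (π.1 j) ≤ W.a (ρ.1 k) := by
    intro j hj
    rw [hπ]
    exact (hsw.mono (hfg j hj)).value_le (hρ.upto k) ((hfb j).trans hj₂).le le_rfl
  have hpos : 0 < W.a (ρ.1 j₁) := hc₁.pos
  have hπpay : W.pay π = 0 := by
    refine leafPay_of_forall_notMem fun j hj => hc₂.2.1.notMem ?_
    rw [hπ] at hj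
    rw [eq_of_mem_leaf W.isVal.leaf ρ.2 hj (hfb j).le]
    exact hj
  have hTup : (W.improve R).FollowedUpto i s π j₂ :=
    fun j hj hv => (hρ.upto j₂).congr hag j hj hv
  -- the improved strategy guarantees a positive payoff, so it leaves `π`
  have hT : ¬ (W.improve R).Followed i s π := by
    intro hT
    have h1 := (hsw.congr (hag.mono hlt.le)).le_pay hT
    rw [hπpay, ← hag j₁ hlt.le] at h1
    omega
  have hZ : ¬ z.Followed π := by
    intro hZ
    obtain ⟨l, ρ₁, hl, hup, e₁, hs₁, hne, -⟩ :=
      W.exists_deviation (fun h => hT ((W.improve R).followed_strategy.1 h))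
    have hjl : j₂ ≤ l := by
      by_contra! hcon
      refine hne ?_
      have h1 := hTup l hcon hl
      rw [h1, (W.improve R).followed_strategy.1 hs₁ l (by rw [← e₁ l le_rfl]; exact hl),
        ← (W.improve R).run_agree s e₁, ← e₁ l le_rfl]
    have h1 := hz.pay_le hW (by rw [← e₁ 0 (Nat.zero_le l), hπ0]) hs₁ hZ e₁.symm
      (by rw [← e₁ l le_rfl]; exact hl) hne.symm
    have h2 := ((hsw.congr (hag.mono hlt.le)).congr (e₁.mono (hlt.le.trans hjl))).le_pay
      ((W.improve R).followed_strategy.1 hs₁)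
    rw [← e₁ j₁ (hlt.le.trans hjl), ← hag j₁ hlt.le] at h2
    omega
  obtain ⟨g, ρ₁, hg, hup, e₁, hs₁, hne, hp⟩ := W.exists_deviation hZ
  have hjg : j₁ ≤ g := by
    by_contra! hcon
    refine hne ?_
    have hzπ := (hzρ.mono hj₂.le).congr hag
    rw [hzπ g (hcon.trans hlt) hg, hs₁ g (by rw [← e₁ g le_rfl]; exact hg)]
    exact z.move_congr (Outcome.hist_eq e₁) _ _
  have hfk : f g + 1 ≤ k := by have := hfb g; omega
  have h00 : (ρ'.tail (f g)).1 0 = π.1 g := by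
    rw [hπ]
    exact (e (f g) (by omega)).symm
  have hsp : Y.Followed i y (π.splice g (ρ'.tail (f g)) h00) := by
    refine (hYπ.upto g).splice ?_ h00
    rw [hrun, Y.run_agree y (e.mono (by omega : f g ≤ k))]
    exact hρ'.tail (f g)
  have hnext : (π.splice g (ρ'.tail (f g)) h00).1 (g + 1) = π.1 (g + 1) := by
    rw [Outcome.splice_add, hπs]
    exact (e (f g + 1) hfk).symm
  have hags := π.agree_splice g (ρ'.tail (f g)) h00
  have h1 := hyz.pay_le hW (by rw [← hags 0 (Nat.zero_le g), hπ0])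
    (Y.followed_strategy.2 hsp) hs₁ (hags.symm.trans e₁)
    (by rw [← hags g le_rfl]; exact hg) (by rw [hnext]; exact hne)
  rw [W.pay_splice, W.pay_tail] at h1
  exact h1.trans (hp.trans (hval g hjg))

/-- A finite-memory strategy which has a common upper bound with the strategy improved with a large
counter is itself weakly dominated by the latter. -/
theorem weakDom_improve_of_upper_bound [Finite V] (hW : G.PaysAs W) {Y : G.toArena.Machine}
    [Finite Y.S] {y : Y.S} {s : Option R.S × ℕ} {z : G.Strategy i} {c : ℕ}
    (hc : ∀ v, W.dist v ≤ c) (hs : c + Nat.card (Y.S × V) ≤ s.2)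
    (hz : G.WeakDom v₀ ((W.improve R).strategy i s) z)
    (hyz : G.WeakDom v₀ (Y.strategy i y) z) :
    G.WeakDom v₀ (Y.strategy i y) ((W.improve R).strategy i s) := by
  refine weakDom_of_pay hW fun ρ' ρ k h0' hρ' hρ e' hk' hne' => ?_
  have e := e'.symm
  have hne := hne'.symm
  have hk : G.owner (ρ.1 k) = i := by rw [e k le_rfl]; exact hk'
  have h0 : ρ.1 0 = v₀ := by rw [e 0 (Nat.zero_le k), h0']
  have hf := (W.improve R).followed_strategy.1 hρ
  by_cases hzρ : z.Followed ρ
  · exact hyz.pay_le hW h0' hρ' hzρ e' hk' hne'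
  obtain ⟨j, ρ₁, hj, hup, e₁, hs₁, hne₁, hp₁⟩ := W.exists_deviation hzρ
  obtain ⟨hsw, hdist, hflat⟩ := hz.of_deviation hW h0 hf hs₁ e₁ hj hne₁
  have hle := hp₁.trans (hsw.le_pay hf)
  rcases lt_trichotomy j k with hjk | rfl | hjk
  · refine (hyz.pay_le hW h0' hρ' hs₁ ((e.mono hjk.le).symm.trans e₁)
      (by rw [← e j hjk.le]; exact hj) ?_).trans hle
    rw [← e (j + 1) hjk]
    exact hne₁
  · by_cases hsame : ρ'.1 (j + 1) = ρ₁.1 (j + 1)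
    · refine le_trans ?_ (hsw.le_pay hf)
      by_cases hh : W.Hopeful (ρ.1 j)
      · refine pay_le_of_long_imitation hW hz hyz h0 hf (Y.followed_strategy.1 hρ') e hup ?_
        have h1 := hdist hh
        have h2 := hc (ρ.1 j)
        omega
      · by_cases hzρ' : z.Followed ρ'
        · exact (hz.of_deviation hW h0 hf hzρ' e hj (by rw [hsame]; exact hne₁)).2.2 hh |>.le
        · obtain ⟨l, ρ₂, hl, hup₂, e₂, hs₂, hne₂, -⟩ := W.exists_deviation hzρ'
          have hjl : j < l := by
            by_contra! hcon
            refine hne₂ (Eq.trans ?_ (hs₁.next_eq hs₂ ?_ ?_))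
            · rcases hcon.lt_or_eq with h | rfl
              · rw [← e (l + 1) h, e₁ (l + 1) h]
              · exact hsame
            · exact (e₁.symm.trans e).mono hcon |>.trans e₂
            · rw [← e₁ l hcon, e l hcon]; exact hl
          refine (hyz.pay_le hW h0' hρ' hs₂ e₂ hl hne₂).trans ?_
          refine ((hz.of_deviation hW h0 hf hs₂ (e.trans (e₂.mono hjl.le)) hj ?_).2.2 hh).le
          rw [← e₂ (j + 1) hjl, hsame]
          exact hne₁
    · exact (hyz.pay_le hW h0' hρ' hs₁ (e'.trans e₁) hk' hsame).trans hle
  · refine (hyz.pay_le hW h0' hρ' hs₁ (e'.trans (e₁.mono hjk.le)) hk' ?_).trans hle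
    rw [← e₁ (k + 1) hjk]
    exact hne'

end Game

end SafetyReach

open SafetyReach SafetyReach.Arena SafetyReach.Game in
theorem theorem4p13 {P V : Type*} [Finite P] [Finite V] (G : SafetyReach.Game P V) (i : P)
    (hG : G.IsGenSafetyReach i) (v₀ : V)
    (σ : G.Strategy i) (hσ : σ.FiniteMemory) (hdom : ∃ σ' : G.Strategy i, G.Dom v₀ σ σ') :
    (∃ τ : G.Strategy i, τ.FiniteMemory ∧ G.Admissible v₀ τ ∧ G.Dom v₀ σ τ) ∨
    (∃ x : ℕ → G.Strategy i, G.IsMaximalUniformChain v₀ x ∧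
      G.ChainDom v₀ (fun _ : Unit => σ) x) := by
  obtain ⟨W, hW⟩ := hG.exists_paysAs
  obtain ⟨𝓜, rfl⟩ := hσ
  let R := 𝓜.toMachine
  have : Finite R.S := 𝓜.finite
  let q : Option R.S := some 𝓜.init
  let t : ℕ → G.Strategy i := fun N => (W.improve R).strategy i (q, N)
  have hσt : ∀ N, G.WeakDom v₀ 𝓜.strategy (t N) := fun N => by
    rw [← 𝓜.strategy_toMachine]
    exact weakDom_improve hW _ N
  have ht : ∀ N N', N ≤ N' → G.WeakDom v₀ (t N) (t N') := fun N N' h =>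
    weakDom_improve_of_le hW q h
  have hfin : ∀ N, (t N).FiniteMemory := fun N => ValuedArena.finiteMemory_improve q N
  obtain ⟨c₀, hc₀⟩ := (Set.finite_range W.dist).bddAbove
  obtain ⟨c, hc, hpos⟩ : ∃ c, (∀ v, W.dist v ≤ c) ∧ 0 < c :=
    ⟨c₀ + 1, fun v => (hc₀ ⟨v, rfl⟩).trans (Nat.le_succ c₀), Nat.succ_pos c₀⟩
  by_cases hcase : ∃ N, ∀ ρ : G.Outcome, ρ.1 0 = v₀ → (W.improve R).Followed i (q, N) ρ →
      ∀ k, c ≤ ((W.improve R).run (q, N) ρ.1 k).2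
  · left
    obtain ⟨N, hN⟩ := hcase
    have hadm : G.Admissible v₀ (t N) := admissible_improve hW hc hN
    refine ⟨t N, hfin N, hadm, hσt N, ?_⟩
    -- otherwise, what dominates `σ` dominates `t N` as well
    by_contra! hcon
    obtain ⟨σ', hwd, τ, hlt⟩ := hdom
    exact hadm σ' ⟨fun τ => (hcon τ).trans (hwd τ), τ, (hcon τ).trans_lt hlt⟩
  · right
    push Not at hcase
    have hstrict : ∀ N, ∃ τ, G.pay v₀ (t N) τ < G.pay v₀ (t (N + c)) τ := by
      intro N
      obtain ⟨ρ, h0, hρ, k, hk⟩ := hcase (N + c)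
      exact exists_pay_lt_improve hW hc h0 hρ ⟨k, hk⟩
    refine ⟨fun n => t (c * n), ⟨fun a b hab => ⟨ht _ _ (Nat.mul_le_mul_left c hab.le), ?_⟩,
      fun n => hfin _, ?_, ?_⟩, fun _ => ⟨0, hσt _⟩⟩
    · obtain ⟨τ, hτ⟩ := hstrict (c * a)
      exact ⟨τ, hτ.trans_le (ht _ _ (by rw [← Nat.mul_succ]; exact Nat.mul_le_mul_left c hab) τ)⟩
    · exact ValuedArena.exists_paramAutomaton q hpos
    · intro α y hy hyfin hxy b
      obtain ⟨𝓨, hb⟩ := hyfin b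
      let Y := 𝓨.toMachine
      have : Finite Y.S := 𝓨.finite
      let n := 1 + Nat.card (Y.S × V)
      obtain ⟨b', hb'⟩ := hxy n
      -- a common upper bound of `y b` and of a late member of the sequence, inside the chain `y`
      have hup : ∃ d, G.WeakDom v₀ (t (c * n)) (y d) ∧ G.WeakDom v₀ (y b) (y d) := by
        rcases lt_trichotomy b b' with h | rfl | h
        · exact ⟨b', hb', (hy _ _ h).1⟩
        · exact ⟨b, hb', WeakDom.refl _⟩
        · exact ⟨b, hb'.trans (hy _ _ h).1, WeakDom.refl _⟩
      obtain ⟨d, hd, hd'⟩ := hup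
      refine ⟨n, ?_⟩
      rw [← hb, ← 𝓨.strategy_toMachine] at hd' ⊢
      refine weakDom_improve_of_upper_bound hW (c := c) hc ?_ hd hd'
      change c + Nat.card (Y.S × V) ≤ c * (1 + Nat.card (Y.S × V))
      nlinarith [Nat.zero_le (Nat.card (Y.S × V))]
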